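/- Let $\mathbb{D}$ be the open unit disc and let $(\alpha_j)_{j\ge 0}$ be random variables, defined on one probability space, with values almost surely in $\mathbb{D}$. Let $(\Phi_n)_{n\ge 0}$ and $(\Phi_n^*)_{n\ge 0}$ be the orthogonal polynomials on the unit circle and the reversed polynomials, $\Phi_n^*(z)=z^n\overline{\Phi_n(1/\bar z)}$, with Verblunsky coefficients $(\alpha_j)_{j\ge 0}$; that is, $\Phi_0=\Phi_0^*=1$ and, for $k\ge 0$ (Szegő recurrence), $$\Phi_{k+1}(z)=z\,\Phi_k(z)-\overline{\alpha_k}\,\Phi_k^*(z),\qquad \Phi_{k+1}^*(z)=-\alpha_k z\,\Phi_k(z)+\Phi_k^*(z).$$ Almost surely, no $\Phi_n^*$ vanishes on $\mathbb{D}$, and $\Phi_n^*(0)=1$; let $\log\Phi_n^*$ denote the unique continuous determination on $\mathbb{D}$ of the logarithm of $\Phi_n^*$ that vanishes at $0$. Assume that the $\alpha_j$ are independent, that each $\alpha_j$ is rotationally invariant (for every $c\in\mathbb{C}$ with $|c|=1$, $c\,\alpha_j$ has the same law as $\alpha_j$), and that $$\forall \sigma>0,\ \forall k\ge 3 \text{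 integer},\qquad \mathbb{E}\Big[\exp\Big(\sigma\sum_{j\ge 0}|\alpha_j|^k\Big)\Big]<\infty .$$ Then: 1. almost surely, the sequence $(\log\Phi_n^*)_{n\ge 0}$ converges uniformly on every compact subset of $\mathbb{D}$; 2. for every compact set $K\subset\mathbb{D}$ and every $\sigma\in\mathbb{C}$, $$\sup_{z\in K}\ \sup_{n\ge 0}\ \mathbb{E}\Big[e^{\Re\left(\sigma\log\Phi_n^*(z)\right)}\Big]<\infty .$$ -/

import Mathlib

open MeasureTheory ProbabilityTheory Filter Topology
open scoped Polynomial ENNReal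

/-- The pair `(Φₙ, Φₙ^*)` of monic orthogonal polynomials on the unit circle and reversed
polynomials attached to the Verblunsky coefficients `a 0, a 1, …`: it starts from `(1, 1)` and obeys
the Szegő recurrence
`Φₖ₊₁(z) = z Φₖ(z) - conj (aₖ) Φₖ^*(z)`, `Φₖ₊₁^*(z) = - aₖ z Φₖ(z) + Φₖ^*(z)`. -/
noncomputable def szegoPair (a : ℕ → ℂ) : ℕ → ℂ[X] × ℂ[X]
  | 0 => (1, 1)
  | k + 1 =>
    (Polynomial.X * (szegoPair a k).1
        - Polynomial.C ((starRingEnd ℂ) (a k)) * (szegoPair a k).2,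
      -(Polynomial.C (a k) * Polynomial.X * (szegoPair a k).1) + (szegoPair a k).2)

/-- The orthogonal polynomial `Φₙ`. -/
noncomputable def opuc (a : ℕ → ℂ) (n : ℕ) : ℂ[X] := (szegoPair a n).1

/-- The reversed polynomial `Φₙ^*`. -/
noncomputable def opucStar (a : ℕ → ℂ) (n : ℕ) : ℂ[X] := (szegoPair a n).2

theorem opuc_eval_succ (a : ℕ → ℂ) (n : ℕ) (z : ℂ) :
    (opuc a (n + 1)).eval z =
      z * (opuc a n).eval z - (starRingEnd ℂ) (a n) * (opucStar a n).eval z := by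
  simp [opuc, opucStar, szegoPair]

theorem opucStar_eval_succ (a : ℕ → ℂ) (n : ℕ) (z : ℂ) :
    (opucStar a (n + 1)).eval z =
      -(a n * z * (opuc a n).eval z) + (opucStar a n).eval z := by
  simp [opuc, opucStar, szegoPair]

/-- `Φₙ(z) = zⁿ conj (Φₙ^*(1 / conj z))` and `Φₙ^*(z) = zⁿ conj (Φₙ(1 / conj z))`. -/
theorem opucStar_eval_eq (a : ℕ → ℂ) (n : ℕ) {z : ℂ} (hz : z ≠ 0) :
    (opuc a n).eval z =
        z ^ n * (starRingEnd ℂ) ((opucStar a n).eval (1 / (starRingEnd ℂ) z)) ∧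
      (opucStar a n).eval z =
        z ^ n * (starRingEnd ℂ) ((opuc a n).eval (1 / (starRingEnd ℂ) z)) := by
  induction n with
  | zero => simp [opuc, opucStar, szegoPair]
  | succ n ih =>
    obtain ⟨h1, h2⟩ := ih
    constructor
    · rw [opuc_eval_succ, opucStar_eval_succ, h1, h2]
      simp only [map_add, map_neg, map_mul, map_div₀, map_one, Complex.conj_conj]
      field_simp
      ring
    · rw [opuc_eval_succ, opucStar_eval_succ, h1, h2]
      simp only [map_sub, map_mul, map_div₀, map_one, Complex.conj_conj]
      field_simp
      ring

/-- `L` is a continuous determination, on the open unit disc, of the logarithm of `f`, with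
`L 0 = 0`. -/
def IsDiscLog (f L : ℂ → ℂ) : Prop :=
  ContinuousOn L (Metric.ball 0 1) ∧ L 0 = 0 ∧
    ∀ z ∈ Metric.ball (0 : ℂ) 1, Complex.exp (L z) = f z

open Classical in
/-- The continuous determination on the open unit disc of the logarithm of `f` that vanishes at `0`
(the zero function if there is none). -/
noncomputable def discLog (f : ℂ → ℂ) : ℂ → ℂ :=
  if h : ∃ L, IsDiscLog f L then h.choose else 0

/-- `log Φₙ^*` on the open unit disc. -/
noncomputable def logOpucStar (a : ℕ → ℂ) (n : ℕ) : ℂ → ℂ :=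
  discLog fun z => (opucStar a n).eval z

theorem IsDiscLog.eqOn {f L M : ℂ → ℂ} (hL : IsDiscLog f L) (hM : IsDiscLog f M) :
    Set.EqOn L M (Metric.ball 0 1) :=
  Complex.isCoveringMap_exp.eqOn_of_comp_eqOn (convex_ball (0 : ℂ) 1).isPreconnected hL.1 hM.1
    (fun z hz => Subtype.ext ((hL.2.2 z hz).trans (hM.2.2 z hz).symm))
    (Metric.mem_ball_self one_pos) (hL.2.1.trans hM.2.1.symm)

theorem opucStar_bound {a : ℕ → ℂ} (ha : ∀ j, ‖a j‖ < 1) (n : ℕ) {z : ℂ}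
    (hz : z ∈ Metric.ball (0 : ℂ) 1) :
    (opucStar a n).eval z ≠ 0 ∧ ‖z * (opuc a n).eval z‖ < ‖(opucStar a n).eval z‖ := by
  have hz1 : ‖z‖ < 1 := by simpa using hz
  induction n with
  | zero => simpa [opuc, opucStar, szegoPair] using hz1
  | succ n ih =>
    rw [opuc_eval_succ, opucStar_eval_succ]
    obtain ⟨-, hlt⟩ := ih
    generalize (opucStar a n).eval z = u at *
    have hc := ha n
    generalize a n = c at *
    rw [mul_assoc]
    generalize z * (opuc a n).eval z = v at *
    have h1 : ‖v - (starRingEnd ℂ) c * u‖ ^ 2 + (1 - ‖c‖ ^ 2) * (‖u‖ ^ 2 - ‖v‖ ^ 2)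
        = ‖-(c * v) + u‖ ^ 2 := by
      simp only [← Complex.normSq_eq_norm_sq, Complex.normSq_apply, Complex.add_re,
        Complex.add_im, Complex.sub_re, Complex.sub_im, Complex.neg_re, Complex.neg_im,
        Complex.mul_re, Complex.mul_im, Complex.conj_re, Complex.conj_im]
      ring
    have hpos : 0 < (1 - ‖c‖ ^ 2) * (‖u‖ ^ 2 - ‖v‖ ^ 2) :=
      mul_pos (by nlinarith [norm_nonneg c]) (by nlinarith [norm_nonneg v])
    have hlt2 : ‖v - (starRingEnd ℂ) c * u‖ < ‖-(c * v) + u‖ :=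
      lt_of_pow_lt_pow_left₀ 2 (norm_nonneg _) (by linarith)
    refine ⟨norm_pos_iff.1 ((norm_nonneg _).trans_lt hlt2), ?_⟩
    rw [norm_mul]
    nlinarith [norm_nonneg (v - (starRingEnd ℂ) c * u)]

theorem exists_isDiscLog {a : ℕ → ℂ} (ha : ∀ j, ‖a j‖ < 1) (n : ℕ) :
    ∃ L, IsDiscLog (fun z => (opucStar a n).eval z) L := by
  induction n with
  | zero => exact ⟨0, continuousOn_const, rfl, by simp [opucStar, szegoPair]⟩
  | succ n ih =>
    obtain ⟨L, hc, h0, he⟩ := ih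
    have hlt : ∀ z ∈ Metric.ball (0 : ℂ) 1,
        ‖-(a n * (z * (opuc a n).eval z / (opucStar a n).eval z))‖ < 1 := by
      intro z hz
      obtain ⟨hne, hb⟩ := opucStar_bound ha n hz
      rw [norm_neg, norm_mul, norm_div]
      have : ‖z * (opuc a n).eval z‖ / ‖(opucStar a n).eval z‖ < 1 :=
        (div_lt_one (norm_pos_iff.2 hne)).2 hb
      exact mul_lt_one_of_nonneg_of_lt_one_left (norm_nonneg _) (ha n) this.le
    refine ⟨fun z => L z +
      Complex.log (1 + -(a n * (z * (opuc a n).eval z / (opucStar a n).eval z))), ?_, ?_, ?_⟩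
    · refine hc.add (ContinuousOn.clog ?_ fun z hz =>
        Complex.mem_slitPlane_of_norm_lt_one (hlt z hz))
      refine continuousOn_const.add (continuousOn_const.mul (ContinuousOn.div ?_ ?_ ?_)).neg
      · exact continuousOn_id.mul (opuc a n).continuous.continuousOn
      · exact (opucStar a n).continuous.continuousOn
      · exact fun z hz => (opucStar_bound ha n hz).1
    · simp [h0]
    · intro z hz
      have hne := (opucStar_bound ha n hz).1
      have hs := Complex.slitPlane_ne_zero (Complex.mem_slitPlane_of_norm_lt_one (hlt z hz))
      simp only [Complex.exp_add, he z hz, Complex.exp_log hs, opucStar_eval_succ]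
      field_simp
      ring

/-- If all coefficients lie in the open unit disc, `logOpucStar a n` is the continuous determination
of the logarithm of `Φₙ^*` on the disc that vanishes at `0`; by `IsDiscLog.eqOn` it is the only
one. -/
theorem isDiscLog_logOpucStar {a : ℕ → ℂ} (ha : ∀ j, ‖a j‖ < 1) (n : ℕ) :
    IsDiscLog (fun z => (opucStar a n).eval z) (logOpucStar a n) := by
  have h := exists_isDiscLog ha n
  rw [logOpucStar, discLog, dif_pos h]
  exact h.choose_spec

/-! Put `Bₙ = z Φₙ / Φₙ^*`. The recurrence factors as `Φₙ₊₁^* = (1 - αₙ Bₙ) Φₙ^*`, so `log Φₙ^* = ∑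
log (1 - αⱼ Bⱼ)`, where `|Bⱼ| < 1` and `Bⱼ` depends only on the `αᵢ` with `i < j`. As `Bₙ₊₁` is `z`
times a disc automorphism applied to `Bₙ`, one has `|Bₙ₊₁| ≤ r (|Bₙ| + |αₙ|)` for `|z| ≤ r < 1`:
past coefficients are forgotten geometrically. Hence `∑ |αⱼ Bⱼ|² ≤ C (1 + ∑ |αⱼ|³)`
(`sum_norm_mul_schurRatio_sq_le`), although `∑ |αⱼ|²` may diverge. This controls the logarithms
beyond first order. The linear part `∑ αⱼ Bⱼ` is a martingale, because `αⱼ` is symmetric and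
independent of the past.

Convergence: the mean squares of its increments on a circle form a submartingale with bounded
expectation (`setLIntegral_incrementEnergy_succ`). Doob's inequality makes the linear part almost
surely Cauchy in `L²` of the circle, and Cauchy's formula turns this into uniform convergence on
smaller discs.

Moments: `cosh t ≤ exp (t² / 2)` makes the exponential of the compensated linear part a
supermartingale (`lintegral_exp_compensatedExponent_le`); the compensator is again bounded through
`∑ |αⱼ|³`, whose exponential moments are assumed.

Conditional expectations never appear: they are replaced by averaging over the sign of `αₙ`
(`two_mul_lintegral_eq_of_indep`). -/

/-! ### The ratios `Bₙ` and their recursion -/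

/-- The Schur-class ratio `z Φₙ(z) / Φₙ^*(z)`. -/
noncomputable def schurRatio (a : ℕ → ℂ) (n : ℕ) (z : ℂ) : ℂ :=
  z * (opuc a n).eval z / (opucStar a n).eval z

theorem norm_schurRatio_lt_one {a : ℕ → ℂ} (ha : ∀ j, ‖a j‖ < 1) (n : ℕ) {z : ℂ}
    (hz : z ∈ Metric.ball (0 : ℂ) 1) : ‖schurRatio a n z‖ < 1 := by
  obtain ⟨hne, hb⟩ := opucStar_bound ha n hz
  rw [schurRatio, norm_div]
  exact (div_lt_one (norm_pos_iff.2 hne)).2 hb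

theorem norm_mul_schurRatio_lt_one {a : ℕ → ℂ} (ha : ∀ j, ‖a j‖ < 1) (n : ℕ) {z : ℂ}
    (hz : z ∈ Metric.ball (0 : ℂ) 1) : ‖-(a n * schurRatio a n z)‖ < 1 := by
  rw [norm_neg, norm_mul]
  exact mul_lt_one_of_nonneg_of_lt_one_left (norm_nonneg _) (ha n)
    (norm_schurRatio_lt_one ha n hz).le

theorem schurRatio_zero (a : ℕ → ℂ) (z : ℂ) : schurRatio a 0 z = z := by
  simp [schurRatio, opuc, opucStar, szegoPair]

theorem schurRatio_succ {a : ℕ → ℂ} (ha : ∀ j, ‖a j‖ < 1) (n : ℕ) {z : ℂ}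
    (hz : z ∈ Metric.ball (0 : ℂ) 1) :
    schurRatio a (n + 1) z =
      z * ((schurRatio a n z - (starRingEnd ℂ) (a n)) / (1 - a n * schurRatio a n z)) := by
  have hne := (opucStar_bound ha n hz).1
  have hne' := (opucStar_bound ha (n + 1) hz).1
  have h1 : schurRatio a n z * (opucStar a n).eval z = z * (opuc a n).eval z := by
    rw [schurRatio, div_mul_cancel₀ _ hne]
  have h2 : (opucStar a (n + 1)).eval z
      = (1 - a n * schurRatio a n z) * (opucStar a n).eval z := by
    rw [opucStar_eval_succ, sub_mul, mul_assoc (a n) (schurRatio a n z), h1]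
    ring
  have h3 : (opuc a (n + 1)).eval z
      = (schurRatio a n z - (starRingEnd ℂ) (a n)) * (opucStar a n).eval z := by
    rw [opuc_eval_succ, sub_mul, h1]
  rw [schurRatio, h2, h3, ← mul_assoc z, mul_div_mul_right _ _ hne, mul_div_assoc]

/-! ### Bounding `∑ |aⱼ Bⱼ|²` by `∑ |aⱼ|³` -/

/-- The triangle inequality for the pseudo-hyperbolic distance, in a weak form. -/
theorem norm_sub_conj_div_le {b c : ℂ} (hb : ‖b‖ < 1) (hc : ‖c‖ < 1) :
    ‖(b - (starRingEnd ℂ) c) / (1 - c * b)‖ ≤ ‖b‖ + ‖c‖ := by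
  have hcb : ‖c * b‖ < 1 := by
    rw [norm_mul]
    exact mul_lt_one_of_nonneg_of_lt_one_left (norm_nonneg _) hc hb.le
  have hpos : 0 < ‖1 - c * b‖ := by
    refine norm_pos_iff.2 (sub_ne_zero.2 fun h => ?_)
    rw [← h, norm_one] at hcb
    exact lt_irrefl _ hcb
  rw [norm_div, div_le_iff₀ hpos]
  set t := (c * b).re with ht
  have h1 : ‖b - (starRingEnd ℂ) c‖ ^ 2 = ‖b‖ ^ 2 + ‖c‖ ^ 2 - 2 * t := by
    simp only [ht, ← Complex.normSq_eq_norm_sq, Complex.normSq_apply, Complex.sub_re,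
      Complex.sub_im, Complex.mul_re, Complex.conj_re, Complex.conj_im]
    ring
  have h2 : ‖1 - c * b‖ ^ 2 = 1 + ‖b‖ ^ 2 * ‖c‖ ^ 2 - 2 * t := by
    simp only [ht, ← Complex.normSq_eq_norm_sq, Complex.normSq_apply, Complex.sub_re,
      Complex.sub_im, Complex.mul_re, Complex.mul_im, Complex.one_re, Complex.one_im]
    ring
  have ht1 : -(‖b‖ * ‖c‖) ≤ t := by
    have := (abs_le.1 (Complex.abs_re_le_norm (c * b))).1
    rw [norm_mul] at this
    linarith
  have hb0 := norm_nonneg b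
  have hc0 := norm_nonneg c
  -- If `‖b‖ + ‖c‖ ≥ 1`, it is enough that a disc automorphism has modulus at most `1`. Otherwise
  -- the difference of squares to be shown nonnegative increases with `t`, so the worst case is `t =
  -- -‖b‖ ‖c‖`.
  by_cases hs : 1 ≤ ‖b‖ + ‖c‖
  · have h3 : ‖b - (starRingEnd ℂ) c‖ ≤ ‖1 - c * b‖ := by
      refine le_of_sq_le_sq ?_ hpos.le
      rw [h1, h2]
      nlinarith [mul_nonneg (by nlinarith : (0 : ℝ) ≤ 1 - ‖b‖ ^ 2)
        (by nlinarith : (0 : ℝ) ≤ 1 - ‖c‖ ^ 2)]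
    nlinarith
  · push Not at hs
    refine le_of_sq_le_sq ?_ (by positivity)
    rw [mul_pow, h1, h2]
    have h4 : 0 ≤ (1 - (‖b‖ + ‖c‖) ^ 2) * (t + ‖b‖ * ‖c‖) :=
      mul_nonneg (by nlinarith) (by linarith)
    have h5 : 0 ≤ (‖b‖ + ‖c‖) ^ 2 * (‖b‖ * ‖c‖) * (2 + ‖b‖ * ‖c‖) := by positivity
    nlinarith

/-- A bound of `|z Φₙ(z) / Φₙ^*(z)|` for `|z| ≤ r`. -/
noncomputable def ratioEnvelope (r : ℝ) (a : ℕ → ℂ) : ℕ → ℝ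
  | 0 => 1
  | n + 1 => r * (ratioEnvelope r a n + ‖a n‖)

theorem ratioEnvelope_nonneg {r : ℝ} (hr : 0 ≤ r) (a : ℕ → ℂ) (n : ℕ) :
    0 ≤ ratioEnvelope r a n := by
  induction n with
  | zero => simp [ratioEnvelope]
  | succ n ih => exact mul_nonneg hr (add_nonneg ih (norm_nonneg _))

theorem mem_ball_of_norm_le {r : ℝ} (hr1 : r < 1) {z : ℂ} (hz : ‖z‖ ≤ r) :
    z ∈ Metric.ball (0 : ℂ) 1 := by
  simpa using hz.trans_lt hr1

theorem norm_schurRatio_le_envelope {a : ℕ → ℂ} (ha : ∀ j, ‖a j‖ < 1) {r : ℝ} (hr1 : r < 1)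
    {z : ℂ} (hz : ‖z‖ ≤ r) (n : ℕ) : ‖schurRatio a n z‖ ≤ ratioEnvelope r a n := by
  have hzb := mem_ball_of_norm_le hr1 hz
  induction n with
  | zero =>
    rw [schurRatio_zero]
    exact (hz.trans_lt hr1).le
  | succ n ih =>
    rw [schurRatio_succ ha n hzb, norm_mul]
    have h := norm_sub_conj_div_le (norm_schurRatio_lt_one ha n hzb) (ha n)
    exact mul_le_mul hz (h.trans (by gcongr)) (norm_nonneg _) ((norm_nonneg z).trans hz)

/-- Convexity of the cube, with `r (x + y)` written as the average of `x` and `r y / (1 - r)` with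
weights `r` and `1 - r`. The coefficient `r < 1` of `x ^ 3` is what makes the recursion summable. -/
theorem cube_mul_add_le {r x y : ℝ} (hr : 0 ≤ r) (hr1 : r < 1) (hx : 0 ≤ x) (hy : 0 ≤ y) :
    (r * (x + y)) ^ 3 ≤ r * x ^ 3 + ((1 - r) ^ 2)⁻¹ * y ^ 3 := by
  have h1r : 0 < 1 - r := by linarith
  have h := (convexOn_pow 3).2 (Set.mem_Ici.2 hx)
    (Set.mem_Ici.2 (show 0 ≤ r * y / (1 - r) by positivity)) hr h1r.le (by ring)
  simp only [smul_eq_mul] at h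
  have e1 : r * x + (1 - r) * (r * y / (1 - r)) = r * (x + y) := by
    field_simp
  have e2 : (1 - r) * (r * y / (1 - r)) ^ 3 = ((1 - r) ^ 2)⁻¹ * (r ^ 3 * y ^ 3) := by
    field_simp
  rw [e1, e2] at h
  refine h.trans ?_
  have : r ^ 3 * y ^ 3 ≤ y ^ 3 :=
    mul_le_of_le_one_left (by positivity) (pow_le_one₀ hr hr1.le)
  gcongr

theorem sum_ratioEnvelope_cube_le {r : ℝ} (hr : 0 ≤ r) (hr1 : r < 1) (a : ℕ → ℂ) (n : ℕ) :
    (1 - r) * ∑ j ∈ Finset.range n, ratioEnvelope r a j ^ 3 + ratioEnvelope r a n ^ 3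
      ≤ 1 + ((1 - r) ^ 2)⁻¹ * ∑ j ∈ Finset.range n, ‖a j‖ ^ 3 := by
  induction n with
  | zero => simp [ratioEnvelope]
  | succ n ih =>
    have h := cube_mul_add_le hr hr1 (ratioEnvelope_nonneg hr a n) (norm_nonneg (a n))
    rw [Finset.sum_range_succ, Finset.sum_range_succ, ratioEnvelope]
    linarith

/-- The constant in the bound of `∑ |aⱼ|² |Bⱼ|²` by `∑ |aⱼ|³`. -/
noncomputable def cubeConst (r : ℝ) : ℝ := 1 + (1 - r)⁻¹ + (1 - r)⁻¹ * ((1 - r) ^ 2)⁻¹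

theorem cubeConst_pos {r : ℝ} (hr1 : r < 1) : 0 < cubeConst r := by
  have h1r : 0 < 1 - r := by linarith
  unfold cubeConst
  positivity

theorem sum_envelope_le {r : ℝ} (hr : 0 ≤ r) (hr1 : r < 1) (a : ℕ → ℂ) (n : ℕ) :
    ∑ j ∈ Finset.range n, (‖a j‖ ^ 3 + ratioEnvelope r a j ^ 3)
      ≤ cubeConst r * (1 + ∑ j ∈ Finset.range n, ‖a j‖ ^ 3) := by
  have h1r : 0 < 1 - r := by linarith
  have h := sum_ratioEnvelope_cube_le hr hr1 a n
  have hn := pow_nonneg (ratioEnvelope_nonneg hr a n) 3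
  have hT : 0 ≤ ∑ j ∈ Finset.range n, ‖a j‖ ^ 3 := Finset.sum_nonneg fun _ _ => by positivity
  rw [Finset.sum_add_distrib]
  have h2 : ∑ j ∈ Finset.range n, ratioEnvelope r a j ^ 3 ≤
      (1 - r)⁻¹ * (1 + ((1 - r) ^ 2)⁻¹ * ∑ j ∈ Finset.range n, ‖a j‖ ^ 3) := by
    rw [← div_eq_inv_mul, le_div_iff₀ h1r]
    linarith
  have h3 : 0 ≤ (1 - r)⁻¹ * ∑ j ∈ Finset.range n, ‖a j‖ ^ 3 := by positivity
  have h4 : 0 ≤ (1 - r)⁻¹ * ((1 - r) ^ 2)⁻¹ := by positivity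
  unfold cubeConst
  nlinarith

/-- Since `|B| ≤ 1`, one factor `|B|` can be dropped: `|a|² |B|² ≤ |a|² e ≤ max(|a|, e)³`, with `e`
the envelope. -/
theorem norm_mul_schurRatio_sq_le {a : ℕ → ℂ} (ha : ∀ j, ‖a j‖ < 1) {r : ℝ} (hr1 : r < 1)
    {z : ℂ} (hz : ‖z‖ ≤ r) (n : ℕ) :
    ‖a n * schurRatio a n z‖ ^ 2 ≤ ‖a n‖ ^ 3 + ratioEnvelope r a n ^ 3 := by
  have h1 := (norm_schurRatio_lt_one ha n (mem_ball_of_norm_le hr1 hz)).le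
  have h2 := norm_schurRatio_le_envelope ha hr1 hz n
  have h3 := norm_nonneg (schurRatio a n z)
  have h4 := norm_nonneg (a n)
  rw [norm_mul, mul_pow]
  generalize ‖schurRatio a n z‖ = b at *
  generalize ratioEnvelope r a n = e at *
  generalize ‖a n‖ = x at *
  have h5 : x ^ 2 * b ^ 2 ≤ x ^ 2 * e := by
    gcongr
    nlinarith
  have he : 0 ≤ e := h3.trans h2
  rcases le_total x e with h | h
  · have : x ^ 2 * e ≤ e ^ 2 * e := by gcongr
    have : 0 ≤ x ^ 3 := by positivity
    nlinarith
  · have : x ^ 2 * e ≤ x ^ 2 * x := by gcongr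
    have : 0 ≤ e ^ 3 := by positivity
    nlinarith

theorem sum_norm_mul_schurRatio_sq_le {a : ℕ → ℂ} (ha : ∀ j, ‖a j‖ < 1) {r : ℝ} (hr1 : r < 1)
    {z : ℂ} (hz : ‖z‖ ≤ r) (n : ℕ) :
    ∑ j ∈ Finset.range n, ‖a j * schurRatio a j z‖ ^ 2
      ≤ cubeConst r * (1 + ∑ j ∈ Finset.range n, ‖a j‖ ^ 3) :=
  (Finset.sum_le_sum fun j _ => norm_mul_schurRatio_sq_le ha hr1 hz j).trans
    (sum_envelope_le ((norm_nonneg z).trans hz) hr1 a n)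

/-! ### The logarithm as a linear part plus a quadratic remainder -/

theorem continuousOn_schurRatio {a : ℕ → ℂ} (ha : ∀ j, ‖a j‖ < 1) (n : ℕ) :
    ContinuousOn (schurRatio a n) (Metric.ball 0 1) :=
  ContinuousOn.div (continuousOn_id.mul (opuc a n).continuous.continuousOn)
    (opucStar a n).continuous.continuousOn fun _ hz => (opucStar_bound ha n hz).1

theorem differentiableOn_schurRatio {a : ℕ → ℂ} (ha : ∀ j, ‖a j‖ < 1) (n : ℕ) :
    DifferentiableOn ℂ (schurRatio a n) (Metric.ball 0 1) :=
  DifferentiableOn.div (differentiableOn_id.mul (opuc a n).differentiable.differentiableOn)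
    (opucStar a n).differentiable.differentiableOn fun _ hz => (opucStar_bound ha n hz).1

theorem isDiscLog_sum_log {a : ℕ → ℂ} (ha : ∀ j, ‖a j‖ < 1) (n : ℕ) :
    IsDiscLog (fun z => (opucStar a n).eval z)
      (fun z => ∑ j ∈ Finset.range n, Complex.log (1 + -(a j * schurRatio a j z))) := by
  refine ⟨continuousOn_finsetSum _ fun j _ => ContinuousOn.clog ?_ fun z hz =>
    Complex.mem_slitPlane_of_norm_lt_one (norm_mul_schurRatio_lt_one ha j hz), ?_, ?_⟩
  · exact continuousOn_const.add (continuousOn_const.mul (continuousOn_schurRatio ha j)).neg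
  · simp [schurRatio]
  · intro z hz
    induction n with
    | zero => simp [opucStar, szegoPair]
    | succ n ih =>
      simp only at ih ⊢
      have hs := Complex.slitPlane_ne_zero
        (Complex.mem_slitPlane_of_norm_lt_one (norm_mul_schurRatio_lt_one ha n hz))
      have hne := (opucStar_bound ha n hz).1
      rw [Finset.sum_range_succ, Complex.exp_add, ih, Complex.exp_log hs, opucStar_eval_succ,
        schurRatio]
      field_simp
      ring

theorem logOpucStar_eq_sum {a : ℕ → ℂ} (ha : ∀ j, ‖a j‖ < 1) (n : ℕ) {z : ℂ}
    (hz : z ∈ Metric.ball (0 : ℂ) 1) :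
    logOpucStar a n z = ∑ j ∈ Finset.range n, Complex.log (1 + -(a j * schurRatio a j z)) :=
  (isDiscLog_logOpucStar ha n).eqOn (isDiscLog_sum_log ha n) hz

theorem norm_sub_conj_div_le_one {b c : ℂ} (hb : ‖b‖ < 1) (hc : ‖c‖ < 1) :
    ‖(b - (starRingEnd ℂ) c) / (1 - c * b)‖ ≤ 1 := by
  rw [norm_div]
  refine div_le_one_of_le₀ (le_of_sq_le_sq ?_ (norm_nonneg _)) (norm_nonneg _)
  have h : ‖1 - c * b‖ ^ 2 - ‖b - (starRingEnd ℂ) c‖ ^ 2 = (1 - ‖b‖ ^ 2) * (1 - ‖c‖ ^ 2) := by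
    simp only [← Complex.normSq_eq_norm_sq, Complex.normSq_apply, Complex.sub_re, Complex.sub_im,
      Complex.mul_re, Complex.mul_im, Complex.conj_re, Complex.conj_im, Complex.one_re,
      Complex.one_im]
    ring
  have h' : 0 ≤ (1 - ‖b‖ ^ 2) * (1 - ‖c‖ ^ 2) :=
    mul_nonneg (by nlinarith [norm_nonneg b]) (by nlinarith [norm_nonneg c])
  linarith

/-- The Schwarz lemma bound. It keeps `aₙ Bₙ` in the disc of radius `r`, so that the Taylor
remainder of the logarithm has a constant uniform in `n`. -/
theorem norm_schurRatio_le {a : ℕ → ℂ} (ha : ∀ j, ‖a j‖ < 1) (n : ℕ) {z : ℂ}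
    (hz : z ∈ Metric.ball (0 : ℂ) 1) : ‖schurRatio a n z‖ ≤ ‖z‖ := by
  cases n with
  | zero => rw [schurRatio_zero]
  | succ n =>
    rw [schurRatio_succ ha n hz, norm_mul]
    exact mul_le_of_le_one_right (norm_nonneg z)
      (norm_sub_conj_div_le_one (norm_schurRatio_lt_one ha n hz) (ha n))

theorem norm_log_sub_le {a : ℕ → ℂ} (ha : ∀ j, ‖a j‖ < 1) {r : ℝ} (hr1 : r < 1)
    {z : ℂ} (hz : ‖z‖ ≤ r) (n : ℕ) :
    ‖Complex.log (1 + -(a n * schurRatio a n z)) - -(a n * schurRatio a n z)‖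
      ≤ (1 - r)⁻¹ * ‖a n * schurRatio a n z‖ ^ 2 := by
  have hzb := mem_ball_of_norm_le hr1 hz
  refine (Complex.norm_log_one_add_sub_self_le (norm_mul_schurRatio_lt_one ha n hzb)).trans ?_
  have hw : ‖a n * schurRatio a n z‖ ≤ r := by
    rw [norm_mul]
    exact (mul_le_of_le_one_left (norm_nonneg _) (ha n).le).trans
      ((norm_schurRatio_le ha n hzb).trans hz)
  rw [norm_neg]
  have h1 : (1 - ‖a n * schurRatio a n z‖)⁻¹ ≤ (1 - r)⁻¹ :=
    inv_anti₀ (by linarith) (by linarith)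
  have h2 : 0 ≤ (1 - r)⁻¹ := inv_nonneg.2 (by linarith)
  have h3 := mul_le_mul_of_nonneg_left h1 (sq_nonneg ‖a n * schurRatio a n z‖)
  have h4 := mul_nonneg (sq_nonneg ‖a n * schurRatio a n z‖) h2
  linarith

/-- The linear part `∑ aⱼ Bⱼ(z)` of `-log Φₙ^*`. -/
noncomputable def linearPart (a : ℕ → ℂ) (n : ℕ) (z : ℂ) : ℂ :=
  ∑ j ∈ Finset.range n, a j * schurRatio a j z

theorem linearPart_succ (a : ℕ → ℂ) (n : ℕ) (z : ℂ) :
    linearPart a (n + 1) z = linearPart a n z + a n * schurRatio a n z :=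
  Finset.sum_range_succ _ _

theorem differentiableOn_linearPart {a : ℕ → ℂ} (ha : ∀ j, ‖a j‖ < 1) (n : ℕ) :
    DifferentiableOn ℂ (linearPart a n) (Metric.ball 0 1) := by
  have : linearPart a n = fun z => ∑ j ∈ Finset.range n, a j * schurRatio a j z := rfl
  rw [this]
  exact DifferentiableOn.fun_sum fun j _ => (differentiableOn_schurRatio ha j).const_mul _

theorem logOpucStar_eq_linearPart {a : ℕ → ℂ} (ha : ∀ j, ‖a j‖ < 1) (n : ℕ) {z : ℂ}
    (hz : z ∈ Metric.ball (0 : ℂ) 1) :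
    logOpucStar a n z = -linearPart a n z + ∑ j ∈ Finset.range n,
      (Complex.log (1 + -(a j * schurRatio a j z)) - -(a j * schurRatio a j z)) := by
  rw [logOpucStar_eq_sum ha n hz, linearPart, Finset.sum_sub_distrib, Finset.sum_neg_distrib]
  ring

/-- If `∑ |aⱼ|³` converges, `log Φₙ^*` converges uniformly on the disc of radius `r` as soon as
its linear part is uniformly Cauchy there. -/
theorem uniformCauchySeqOn_logOpucStar {a : ℕ → ℂ} (ha : ∀ j, ‖a j‖ < 1)
    (hsum : Summable fun j => ‖a j‖ ^ 3) {r : ℝ} (hr : 0 ≤ r) (hr1 : r < 1)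
    (hlin : UniformCauchySeqOn (linearPart a) atTop (Metric.closedBall 0 r)) :
    UniformCauchySeqOn (logOpucStar a) atTop (Metric.closedBall 0 r) := by
  have hsub : ∀ z ∈ Metric.closedBall (0 : ℂ) r, ‖z‖ ≤ r := fun z hz => by simpa using hz
  have henv : Summable fun j => (1 - r)⁻¹ * (‖a j‖ ^ 3 + ratioEnvelope r a j ^ 3) := by
    refine Summable.mul_left _ (summable_of_sum_range_le (c := cubeConst r * (1 + ∑' j, ‖a j‖ ^ 3))
      (fun j => add_nonneg (by positivity) (pow_nonneg (ratioEnvelope_nonneg hr a j) 3))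
      fun n => (sum_envelope_le hr hr1 a n).trans ?_)
    have := hsum.sum_le_tsum (Finset.range n) fun _ _ => by positivity
    exact mul_le_mul_of_nonneg_left (by linarith) (cubeConst_pos hr1).le
  -- Weierstrass test for the remainders, with the envelope as majorant.
  have hrem := (tendstoUniformlyOn_tsum_nat henv (s := Metric.closedBall (0 : ℂ) r)
    (f := fun j z => Complex.log (1 + -(a j * schurRatio a j z)) - -(a j * schurRatio a j z))
    fun j z hz => (norm_log_sub_le ha hr1 (hsub z hz) j).trans
      (mul_le_mul_of_nonneg_left (norm_mul_schurRatio_sq_le ha hr1 (hsub z hz) j)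
        (inv_nonneg.2 (by linarith)))).uniformCauchySeqOn
  have hadd := hlin.neg.add hrem
  intro u hu
  filter_upwards [hadd u hu] with p hp z hz
  have hzb := mem_ball_of_norm_le hr1 (hsub z hz)
  rw [logOpucStar_eq_linearPart ha _ hzb, logOpucStar_eq_linearPart ha _ hzb]
  exact hp z hz

/-! ### Pathwise bound of the exponential -/

/-- The exponent `∑ (Re (τ Bⱼ aⱼ) - |τ Bⱼ aⱼ|² / 2)`, a linear term with its quadratic
compensator. -/
noncomputable def compensatedExponent (τ : ℂ) (a : ℕ → ℂ) (n : ℕ) (z : ℂ) : ℝ :=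
  ∑ j ∈ Finset.range n, ((τ * schurRatio a j z * a j).re - ‖τ * schurRatio a j z * a j‖ ^ 2 / 2)

theorem compensatedExponent_succ (τ : ℂ) (a : ℕ → ℂ) (n : ℕ) (z : ℂ) :
    compensatedExponent τ a (n + 1) z = compensatedExponent τ a n z +
      ((τ * schurRatio a n z * a n).re - ‖τ * schurRatio a n z * a n‖ ^ 2 / 2) :=
  Finset.sum_range_succ _ _

/-- A pointwise substitute for the Cauchy–Schwarz inequality: it separates the supermartingale from
the function of `∑ |aⱼ|³`, and expectations can then be taken term by term. -/
theorem exp_half_add_le (x y : ℝ) : Real.exp (x / 2 + y) ≤ Real.exp x + Real.exp (2 * y) := by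
  have h1 : Real.exp x = Real.exp (x / 2) ^ 2 := by
    rw [← Real.exp_nat_mul]
    congr 1
    push_cast
    ring
  have h2 : Real.exp (2 * y) = Real.exp y ^ 2 := by rw [← Real.exp_nat_mul]; norm_cast
  rw [Real.exp_add, h1, h2]
  nlinarith [sq_nonneg (Real.exp (x / 2) - Real.exp y), sq_nonneg (Real.exp (x / 2)),
    sq_nonneg (Real.exp y)]

/-- The parameter `-(2 * σ)` has the sign of the linear part, doubled to offset the half in
`exp_half_add_le`. Half of its compensator costs `‖σ‖ ^ 2 ∑ |aⱼ Bⱼ|²`, and the logarithmic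
remainders cost `‖σ‖ (1 - r)⁻¹ ∑ |aⱼ Bⱼ|²`. -/
theorem exp_re_logOpucStar_le {a : ℕ → ℂ} (ha : ∀ j, ‖a j‖ < 1) {r : ℝ} (hr1 : r < 1)
    {z : ℂ} (hz : ‖z‖ ≤ r) (σ : ℂ) (n : ℕ) :
    Real.exp (σ * logOpucStar a n z).re ≤
      Real.exp (compensatedExponent (-(2 * σ)) a n z) +
        Real.exp (2 * ((‖σ‖ ^ 2 + ‖σ‖ * (1 - r)⁻¹) * (cubeConst r *
          (1 + ∑ j ∈ Finset.range n, ‖a j‖ ^ 3)))) := by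
  refine le_trans (Real.exp_le_exp.2 ?_) (exp_half_add_le _ _)
  have hinv : 0 ≤ (1 - r)⁻¹ := inv_nonneg.2 (by linarith)
  have hQ := sum_norm_mul_schurRatio_sq_le ha hr1 hz n
  have hQ' := mul_le_mul_of_nonneg_left hQ
    (show 0 ≤ ‖σ‖ ^ 2 + ‖σ‖ * (1 - r)⁻¹ by positivity)
  refine le_trans ?_ (add_le_add_right hQ' _)
  rw [logOpucStar_eq_linearPart ha n (mem_ball_of_norm_le hr1 hz), mul_add, Complex.add_re]
  have hrem : (σ * ∑ j ∈ Finset.range n, (Complex.log (1 + -(a j * schurRatio a j z))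
      - -(a j * schurRatio a j z))).re
      ≤ ‖σ‖ * ((1 - r)⁻¹ * ∑ j ∈ Finset.range n, ‖a j * schurRatio a j z‖ ^ 2) := by
    refine (Complex.re_le_norm _).trans ?_
    rw [norm_mul, Finset.mul_sum]
    exact mul_le_mul_of_nonneg_left
      (norm_sum_le_of_le _ fun j _ => norm_log_sub_le ha hr1 hz j) (norm_nonneg σ)
  have hlin : compensatedExponent (-(2 * σ)) a n z / 2
      = (σ * -linearPart a n z).re
        - ‖σ‖ ^ 2 * ∑ j ∈ Finset.range n, ‖a j * schurRatio a j z‖ ^ 2 := by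
    rw [compensatedExponent, linearPart, ← Finset.sum_neg_distrib, Finset.mul_sum, Finset.mul_sum,
      Complex.re_sum, ← Finset.sum_sub_distrib, Finset.sum_div]
    refine Finset.sum_congr rfl fun j _ => ?_
    have e1 : -(2 * σ) * schurRatio a j z * a j = (2 : ℝ) * (σ * -(a j * schurRatio a j z)) := by
      push_cast
      ring
    rw [e1, Complex.re_ofReal_mul, norm_mul, norm_mul, norm_neg, Complex.norm_real]
    norm_num
    ring
  rw [hlin]
  linarith

/-! ### Independence of the past and symmetry -/

/-- The σ-algebra generated by `α i`, `i < n`. -/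
@[reducible]
noncomputable def pastAlgebra {Ω : Type*} (α : ℕ → Ω → ℂ) (n : ℕ) : MeasurableSpace Ω :=
  ⨆ i ∈ Set.Iio n, MeasurableSpace.comap (α i) inferInstance

theorem pastAlgebra_mono {Ω : Type*} (α : ℕ → Ω → ℂ) : Monotone (pastAlgebra α) :=
  fun _ _ h => biSup_mono fun _ hi => lt_of_lt_of_le hi h

theorem pastAlgebra_le {Ω : Type*} [MeasurableSpace Ω] {α : ℕ → Ω → ℂ}
    (hα : ∀ j, Measurable (α j)) (n : ℕ) : pastAlgebra α n ≤ ‹MeasurableSpace Ω› :=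
  iSup₂_le fun i _ => (hα i).comap_le

theorem measurable_pastAlgebra {Ω : Type*} (α : ℕ → Ω → ℂ) {i n : ℕ} (hi : i < n) :
    Measurable[pastAlgebra α n] (α i) :=
  Measurable.of_comap_le (le_iSup₂_of_le i hi le_rfl)

theorem indep_pastAlgebra {Ω : Type*} [MeasurableSpace Ω] {P : Measure Ω} {α : ℕ → Ω → ℂ}
    (hα : ∀ j, Measurable (α j)) (hindep : iIndepFun α P) (n : ℕ) :
    Indep (pastAlgebra α n) (MeasurableSpace.comap (α n) inferInstance) P := by
  have h := indep_iSup_of_disjoint (fun i => (hα i).comap_le) hindep.iIndep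
    (S := Set.Iio n) (T := {n}) (by simp)
  simpa [pastAlgebra] using h

/-- The pairs `(Z, -X)` and `(Z, X)` have the same law, namely the product of the same marginals. -/
theorem lintegral_comp_neg_of_indepFun {Ω E : Type*} [MeasurableSpace Ω] [MeasurableSpace E]
    {P : Measure Ω} [IsProbabilityMeasure P] {Z : Ω → E} (hZ : Measurable Z) {X : Ω → ℂ}
    (hX : Measurable X) (hind : IndepFun Z X P)
    (hsymm : IdentDistrib (fun ω => -X ω) X P P) {F : E × ℂ → ℝ≥0∞} (hF : Measurable F) :
    ∫⁻ ω, F (Z ω, -X ω) ∂P = ∫⁻ ω, F (Z ω, X ω) ∂P := by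
  have h1 := (indepFun_iff_map_prod_eq_prod_map_map hZ.aemeasurable hX.aemeasurable).1 hind
  have h2 := (indepFun_iff_map_prod_eq_prod_map_map hZ.aemeasurable hX.neg.aemeasurable).1
    (hind.comp (measurable_id : Measurable (id : E → E))
      (measurable_neg : Measurable (Neg.neg : ℂ → ℂ)))
  have h3 : P.map (fun ω => (Z ω, -X ω)) = P.map (fun ω => (Z ω, X ω)) := by
    rw [h1, ← hsymm.map_eq]
    exact h2
  have hX' : Measurable fun ω => -X ω := hX.neg
  rw [← lintegral_map hF (hZ.prodMk hX'), ← lintegral_map hF (hZ.prodMk hX), ← h3]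

/-- If `X` is symmetric and independent of `m`, then `F (ω, X ω)` may be averaged with
`F (ω, -X ω)` for any `F` that depends on `ω` through `m`. -/
theorem two_mul_lintegral_eq_of_indep {Ω : Type*} {m mΩ : MeasurableSpace Ω} (hm : m ≤ mΩ)
    {P : Measure Ω} [IsProbabilityMeasure P] {X : Ω → ℂ} (hX : Measurable X)
    (hind : Indep m (MeasurableSpace.comap X inferInstance) P)
    (hsymm : IdentDistrib (fun ω => -X ω) X P P) {F : Ω × ℂ → ℝ≥0∞}
    (hF : Measurable[m.prod inferInstance] F) :
    2 * ∫⁻ ω, F (ω, X ω) ∂P = ∫⁻ ω, (F (ω, X ω) + F (ω, -X ω)) ∂P := by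
  have hF' : Measurable F := hF.mono (sup_le_sup (MeasurableSpace.comap_mono hm) le_rfl) le_rfl
  -- The identity map into `(Ω, m)` generates `m`, so it serves as a random variable encoding the
  -- past.
  have hind' : @IndepFun Ω Ω ℂ mΩ m _ id X P := by
    refine (@IndepFun_iff_Indep Ω Ω ℂ mΩ m _ id X P).2 ?_
    rw [MeasurableSpace.comap_id]
    exact hind
  have h := @lintegral_comp_neg_of_indepFun Ω Ω mΩ m P _ id (measurable_id'' hm) X hX hind' hsymm
    F hF
  simp only [id] at h
  have hFX : Measurable fun ω => F (ω, X ω) := hF'.comp (measurable_id.prodMk hX)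
  rw [lintegral_add_left hFX, h, two_mul]

/-- Only `α i` with `i < n` are required to be measurable, so that the σ-algebra may be `pastAlgebra
α n`: this is the predictability of `Bₙ`. Joint measurability in `(ω, z)` allows integration over
`z`. -/
theorem measurable_szegoPair_eval {Ω : Type*} [MeasurableSpace Ω] {α : ℕ → Ω → ℂ} {n : ℕ}
    (hα : ∀ i < n, Measurable (α i)) :
    Measurable (fun p : Ω × ℂ => (opuc (fun j => α j p.1) n).eval p.2) ∧
      Measurable (fun p : Ω × ℂ => (opucStar (fun j => α j p.1) n).eval p.2) := by
  induction n with
  | zero => simp [opuc, opucStar, szegoPair]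
  | succ n ih =>
    obtain ⟨h1, h2⟩ := ih fun i hi => hα i (hi.trans n.lt_succ_self)
    have ha : Measurable fun p : Ω × ℂ => α n p.1 := (hα n n.lt_succ_self).comp measurable_fst
    simp only [opuc_eval_succ, opucStar_eval_succ]
    exact ⟨(measurable_snd.mul h1).sub ((Complex.continuous_conj.measurable.comp ha).mul h2),
      (((ha.mul measurable_snd).mul h1).neg).add h2⟩

theorem measurable_schurRatio {Ω : Type*} [MeasurableSpace Ω] {α : ℕ → Ω → ℂ} {n : ℕ}
    (hα : ∀ i < n, Measurable (α i)) :
    Measurable (fun p : Ω × ℂ => schurRatio (fun j => α j p.1) n p.2) := by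
  obtain ⟨h1, h2⟩ := measurable_szegoPair_eval hα
  exact (measurable_snd.mul h1).div h2

theorem measurable_linearPart {Ω : Type*} [MeasurableSpace Ω] {α : ℕ → Ω → ℂ} {n : ℕ}
    (hα : ∀ i < n, Measurable (α i)) :
    Measurable (fun p : Ω × ℂ => linearPart (fun j => α j p.1) n p.2) :=
  Finset.measurable_fun_sum _ fun j hj =>
    ((hα j (Finset.mem_range.1 hj)).comp measurable_fst).mul
      (measurable_schurRatio fun i hi => hα i (hi.trans (Finset.mem_range.1 hj)))

theorem measurable_compensatedExponent {Ω : Type*} [MeasurableSpace Ω] {α : ℕ → Ω → ℂ} {n : ℕ}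
    (hα : ∀ i < n, Measurable (α i)) (τ z : ℂ) :
    Measurable (fun ω => compensatedExponent τ (fun j => α j ω) n z) := by
  refine Finset.measurable_fun_sum _ fun j hj => ?_
  have h : Measurable fun ω => τ * schurRatio (fun j => α j ω) j z * α j ω :=
    (measurable_const.mul ((measurable_schurRatio fun i hi =>
      hα i (hi.trans (Finset.mem_range.1 hj))).comp (measurable_id.prodMk measurable_const))).mul
      (hα j (Finset.mem_range.1 hj))
  exact (Complex.measurable_re.comp h).sub ((h.norm.pow_const 2).div_const 2)

/-! ### The exponential supermartingale -/

theorem exp_re_sub_add_exp_neg_re_sub_le (w : ℂ) :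
    Real.exp (w.re - ‖w‖ ^ 2 / 2) + Real.exp ((-w).re - ‖-w‖ ^ 2 / 2) ≤ 2 := by
  have h1 : Real.exp w.re + Real.exp (-w.re) ≤ 2 * Real.exp (‖w‖ ^ 2 / 2) := by
    have h := Real.cosh_le_exp_half_sq w.re
    rw [Real.cosh_eq] at h
    have h' : Real.exp (w.re ^ 2 / 2) ≤ Real.exp (‖w‖ ^ 2 / 2) := by
      rw [Real.exp_le_exp, ← sq_abs w.re]
      have := Complex.abs_re_le_norm w
      gcongr
    linarith
  rw [norm_neg, Complex.neg_re, Real.exp_sub, Real.exp_sub, ← add_div,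
    div_le_iff₀ (Real.exp_pos _)]
  exact h1

/-- Given the past, the last factor averaged over the sign of `α n` is at most `1`, so the
expectation does not increase with `n`. -/
theorem lintegral_exp_compensatedExponent_le {Ω : Type*} [MeasurableSpace Ω] {P : Measure Ω}
    [IsProbabilityMeasure P] {α : ℕ → Ω → ℂ} (hα : ∀ j, Measurable (α j))
    (hindep : iIndepFun α P) (hsymm : ∀ j, IdentDistrib (fun ω => -α j ω) (α j) P P)
    (τ z : ℂ) (n : ℕ) :
    ∫⁻ ω, ENNReal.ofReal (Real.exp (compensatedExponent τ (fun j => α j ω) n z)) ∂P ≤ 1 := by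
  induction n with
  | zero => simp [compensatedExponent]
  | succ n ih =>
    refine le_trans ?_ ih
    set G : Ω → ℝ≥0∞ := fun ω =>
      ENNReal.ofReal (Real.exp (compensatedExponent τ (fun j => α j ω) n z)) with hG
    set F : Ω × ℂ → ℝ≥0∞ := fun p => G p.1 * ENNReal.ofReal (Real.exp
      ((τ * schurRatio (fun j => α j p.1) n z * p.2).re
        - ‖τ * schurRatio (fun j => α j p.1) n z * p.2‖ ^ 2 / 2)) with hF
    have hFG : ∀ ω x, F (ω, x) + F (ω, -x) ≤ 2 * G ω := by
      intro ω x
      simp only [hF]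
      rw [← mul_add, ← ENNReal.ofReal_add (Real.exp_pos _).le (Real.exp_pos _).le, mul_comm]
      gcongr
      rw [mul_neg]
      exact ENNReal.ofReal_le_of_le_toReal (exp_re_sub_add_exp_neg_re_sub_le _)
    have hFm : Measurable[(pastAlgebra α n).prod inferInstance] F := by
      let _ := pastAlgebra α n
      have hpast : ∀ i < n, Measurable (α i) := fun i hi => measurable_pastAlgebra α hi
      have h : Measurable fun p : Ω × ℂ => τ * schurRatio (fun j => α j p.1) n z * p.2 :=
        (measurable_const.mul ((measurable_schurRatio hpast).comp
          (measurable_fst.prodMk measurable_const))).mul measurable_snd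
      exact ((measurable_compensatedExponent hpast τ z).exp.ennreal_ofReal.comp measurable_fst).mul
        ((Complex.measurable_re.comp h).sub ((h.norm.pow_const 2).div_const 2)).exp.ennreal_ofReal
    have key := two_mul_lintegral_eq_of_indep (pastAlgebra_le hα n) (hα n)
      (indep_pastAlgebra hα hindep n) (hsymm n) hFm
    have hle : 2 * ∫⁻ ω, F (ω, α n ω) ∂P ≤ 2 * ∫⁻ ω, G ω ∂P := by
      rw [key, ← lintegral_const_mul' _ _ (by simp)]
      exact lintegral_mono fun ω => hFG ω _
    have hle' := (ENNReal.mul_le_mul_iff_right (by simp) (by simp)).1 hle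
    refine le_trans (le_of_eq (lintegral_congr fun ω => ?_)) hle'
    simp only [hF, hG]
    rw [compensatedExponent_succ, Real.exp_add, ENNReal.ofReal_mul (Real.exp_pos _).le]

/-! ### Mean-square increments of the linear part -/

theorem enorm_add_sq_add_enorm_sub_sq (u v : ℂ) :
    ‖u + v‖ₑ ^ 2 + ‖u - v‖ₑ ^ 2 = 2 * (‖u‖ₑ ^ 2 + ‖v‖ₑ ^ 2) := by
  simp only [← ofReal_norm]
  rw [← ENNReal.ofReal_pow (norm_nonneg _), ← ENNReal.ofReal_pow (norm_nonneg _),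
    ← ENNReal.ofReal_pow (norm_nonneg _), ← ENNReal.ofReal_pow (norm_nonneg _),
    ← ENNReal.ofReal_add (by positivity) (by positivity),
    ← ENNReal.ofReal_add (by positivity) (by positivity),
    ← ENNReal.ofReal_ofNat, ← ENNReal.ofReal_mul (by norm_num)]
  congr 1
  have := parallelogram_law_with_norm ℝ u v
  nlinarith

/-- The squared `L²(ν)` distance of `linearPart (N + k)` and `linearPart N`. -/
noncomputable def incrementEnergy (ν : Measure ℂ) (a : ℕ → ℂ) (N k : ℕ) : ℝ≥0∞ :=
  ∫⁻ z, ‖linearPart a (N + k) z - linearPart a N z‖ₑ ^ 2 ∂ν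

/-- The squared `L²(ν)` norm of the `n`-th term of the linear part. -/
noncomputable def termEnergy (ν : Measure ℂ) (a : ℕ → ℂ) (n : ℕ) : ℝ≥0∞ :=
  ∫⁻ z, ‖a n * schurRatio a n z‖ₑ ^ 2 ∂ν

theorem measurable_linearPart_sub {Ω : Type*} [MeasurableSpace Ω] {α : ℕ → Ω → ℂ} {N k : ℕ}
    (hα : ∀ i < N + k, Measurable (α i)) :
    Measurable (fun p : Ω × ℂ => linearPart (fun j => α j p.1) (N + k) p.2
      - linearPart (fun j => α j p.1) N p.2) :=
  (measurable_linearPart hα).sub (measurable_linearPart fun i hi => hα i (by lia))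

theorem measurable_incrementEnergy {Ω : Type*} [MeasurableSpace Ω] (ν : Measure ℂ) [SFinite ν]
    {α : ℕ → Ω → ℂ} {N k : ℕ} (hα : ∀ i < N + k, Measurable (α i)) :
    Measurable (fun ω => incrementEnergy ν (fun j => α j ω) N k) :=
  ((measurable_linearPart_sub hα).enorm.pow_const 2).lintegral_prod_right'

theorem measurable_termEnergy {Ω : Type*} [MeasurableSpace Ω] (ν : Measure ℂ) [SFinite ν]
    {α : ℕ → Ω → ℂ} (hα : ∀ i, Measurable (α i)) (n : ℕ) :
    Measurable (fun ω => termEnergy ν (fun j => α j ω) n) :=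
  ((((hα n).comp measurable_fst).mul
    (measurable_schurRatio fun i _ => hα i)).enorm.pow_const 2).lintegral_prod_right'

theorem measurable_schurRatio_apply (a : ℕ → ℂ) (n : ℕ) : Measurable (schurRatio a n) :=
  (measurable_id.mul (opuc a n).continuous.measurable).div (opucStar a n).continuous.measurable

theorem measurable_linearPart_apply (a : ℕ → ℂ) (n : ℕ) : Measurable (linearPart a n) :=
  Finset.measurable_fun_sum _ fun j _ => measurable_const.mul (measurable_schurRatio_apply a j)

theorem measurable_indicator_mul_lintegral {Ω : Type*} [MeasurableSpace Ω] (ν : Measure ℂ)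
    [SFinite ν] {A : Set Ω} (hA : MeasurableSet A) {D B : Ω → ℂ → ℂ}
    (hD : Measurable fun p : Ω × ℂ => D p.1 p.2) (hB : Measurable fun p : Ω × ℂ => B p.1 p.2) :
    Measurable fun p : Ω × ℂ =>
      A.indicator (1 : Ω → ℝ≥0∞) p.1 * ∫⁻ z, ‖D p.1 z + p.2 * B p.1 z‖ₑ ^ 2 ∂ν := by
  have h0 : Measurable fun q : (Ω × ℂ) × ℂ => (q.1.1, q.2) :=
    (measurable_fst.comp measurable_fst).prodMk measurable_snd
  have h1 : Measurable fun q : (Ω × ℂ) × ℂ => D q.1.1 q.2 := hD.comp h0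
  have h2 : Measurable fun q : (Ω × ℂ) × ℂ => B q.1.1 q.2 := hB.comp h0
  have h3 : Measurable fun q : (Ω × ℂ) × ℂ => q.1.2 := measurable_snd.comp measurable_fst
  have h4 : Measurable fun q : (Ω × ℂ) × ℂ => ‖D q.1.1 q.2 + q.1.2 * B q.1.1 q.2‖ₑ ^ 2 :=
    (h1.add (h3.mul h2)).enorm.pow_const 2
  have h5 : Measurable fun p : Ω × ℂ => A.indicator (1 : Ω → ℝ≥0∞) p.1 :=
    (measurable_one.indicator hA).comp measurable_fst
  exact h5.mul h4.lintegral_prod_right'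

theorem lintegral_indicator_mul_add_symm {Ω : Type*} (ν : Measure ℂ) (A : Set Ω) {D B : ℂ → ℂ}
    (hD : Measurable D) (hB : Measurable B) (ω : Ω) (x : ℂ) :
    A.indicator (1 : Ω → ℝ≥0∞) ω * ∫⁻ z, ‖D z + x * B z‖ₑ ^ 2 ∂ν
        + A.indicator (1 : Ω → ℝ≥0∞) ω * ∫⁻ z, ‖D z + -x * B z‖ₑ ^ 2 ∂ν
      = 2 * (A.indicator (1 : Ω → ℝ≥0∞) ω *
        (∫⁻ z, ‖D z‖ₑ ^ 2 ∂ν + ∫⁻ z, ‖x * B z‖ₑ ^ 2 ∂ν)) := by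
  have h1 : Measurable fun z => ‖D z + x * B z‖ₑ ^ 2 :=
    (hD.add (hB.const_mul x)).enorm.pow_const 2
  have h2 : Measurable fun z => ‖D z‖ₑ ^ 2 := hD.enorm.pow_const 2
  rw [← mul_add, ← lintegral_add_left h1, ← lintegral_add_left h2, mul_left_comm]
  congr 1
  rw [← lintegral_const_mul' _ _ (by simp)]
  refine lintegral_congr fun z => ?_
  rw [neg_mul, ← sub_eq_add_neg, enorm_add_sq_add_enorm_sub_sq]

/-- Orthogonality of martingale increments: averaging over the sign of `α (N + k)` removes the cross
term, by the parallelogram law, since the other ingredients and `A` belong to the past. General `A`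
gives the submartingale property, and `A = univ` gives Pythagoras. -/
theorem setLIntegral_incrementEnergy_succ {Ω : Type*} [MeasurableSpace Ω] {P : Measure Ω}
    [IsProbabilityMeasure P] {α : ℕ → Ω → ℂ} (hα : ∀ j, Measurable (α j))
    (hindep : iIndepFun α P) (hsymm : ∀ j, IdentDistrib (fun ω => -α j ω) (α j) P P)
    (ν : Measure ℂ) [SFinite ν] (N k : ℕ) {A : Set Ω}
    (hA : MeasurableSet[pastAlgebra α (N + k)] A) :
    ∫⁻ ω in A, incrementEnergy ν (fun j => α j ω) N (k + 1) ∂P =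
      ∫⁻ ω in A, incrementEnergy ν (fun j => α j ω) N k ∂P
        + ∫⁻ ω in A, termEnergy ν (fun j => α j ω) (N + k) ∂P := by
  have hFm := @measurable_indicator_mul_lintegral Ω (pastAlgebra α (N + k)) ν _ A hA
    (fun ω z => linearPart (fun j => α j ω) (N + k) z - linearPart (fun j => α j ω) N z)
    (fun ω z => schurRatio (fun j => α j ω) (N + k) z)
    (@measurable_linearPart_sub Ω (pastAlgebra α (N + k)) α N k
      fun i hi => measurable_pastAlgebra α hi)
    (@measurable_schurRatio Ω (pastAlgebra α (N + k)) α (N + k)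
      fun i hi => measurable_pastAlgebra α hi)
  have key := two_mul_lintegral_eq_of_indep (pastAlgebra_le hα (N + k)) (hα (N + k))
    (indep_pastAlgebra hα hindep (N + k)) (hsymm (N + k)) hFm
  have hsum := fun ω => lintegral_indicator_mul_add_symm ν A
    ((measurable_linearPart_apply (fun j => α j ω) (N + k)).sub
      (measurable_linearPart_apply (fun j => α j ω) N))
    (measurable_schurRatio_apply (fun j => α j ω) (N + k)) ω (α (N + k) ω)
  simp only [Pi.sub_apply] at hsum
  rw [lintegral_congr hsum, lintegral_const_mul' _ _ (by simp)] at key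
  have key' := (ENNReal.mul_right_inj (by simp) (by simp)).1 key
  have hA' : MeasurableSet A := pastAlgebra_le hα (N + k) A hA
  have hind : ∀ f : Ω → ℝ≥0∞, ∫⁻ ω, A.indicator 1 ω * f ω ∂P = ∫⁻ ω in A, f ω ∂P := by
    intro f
    rw [← lintegral_indicator hA']
    refine lintegral_congr fun ω => ?_
    by_cases h : ω ∈ A <;> simp [h]
  have hY : Measurable fun ω => incrementEnergy ν (fun j => α j ω) N k :=
    measurable_incrementEnergy ν fun i _ => hα i
  rw [hind, hind] at key'
  rw [← lintegral_add_left hY]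
  refine Eq.trans (lintegral_congr fun ω => lintegral_congr fun z => ?_) key'
  rw [← Nat.add_assoc, linearPart_succ]
  congr 2
  ring

/-! ### Maximal inequality and the almost sure Cauchy property -/

/-- Doob's maximal inequality for a nonnegative submartingale, in terms of lower integrals. -/
theorem measure_exists_le_submartingale {Ω : Type*} [mΩ : MeasurableSpace Ω] {P : Measure Ω}
    {m : ℕ → MeasurableSpace Ω} (hmono : Monotone m) (hm : ∀ n, m n ≤ mΩ) {Y : ℕ → Ω → ℝ≥0∞}
    (hY : ∀ n, Measurable[m n] (Y n))
    (hsub : ∀ n A, MeasurableSet[m n] A → ∫⁻ ω in A, Y n ω ∂P ≤ ∫⁻ ω in A, Y (n + 1) ω ∂P)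
    {c : ℝ≥0∞} (hc : ∀ n, ∫⁻ ω, Y n ω ∂P ≤ c) (ε : ℝ≥0∞) :
    ε * P {ω | ∃ k, ε ≤ Y k ω} ≤ c := by
  set G : ℕ → Set Ω := fun n => {ω | ∃ k ≤ n, ε ≤ Y k ω} with hG
  have hGm : ∀ n, MeasurableSet[m n] (G n) := by
    intro n
    have : G n = ⋃ k ∈ Set.Iic n, {ω | ε ≤ Y k ω} := by
      ext ω
      simp [hG]
    rw [this]
    exact MeasurableSet.biUnion (Set.to_countable _) fun k hk =>
      hmono hk _ ((hY k) measurableSet_Ici)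
  -- Decomposition by first passage: on `G n` the submartingale property moves the bound from time
  -- `n` to `n + 1`; on `G (n + 1) \ G n` the level is reached exactly at time `n + 1`.
  have hstep : ∀ n, ε * P (G n) ≤ ∫⁻ ω in G n, Y n ω ∂P := by
    intro n
    induction n with
    | zero =>
      rw [← setLIntegral_const]
      refine setLIntegral_mono ((hY 0).mono (hm 0) le_rfl) fun ω hω => ?_
      obtain ⟨k, hk, h⟩ := hω
      rwa [Nat.le_zero.1 hk] at h
    | succ n ih =>
      have hGn : MeasurableSet (G n) := hm n _ (hGm n)
      have hsub' : G n ⊆ G (n + 1) := fun ω ⟨k, hk, h⟩ => ⟨k, hk.trans n.le_succ, h⟩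
      have hdiff : MeasurableSet (G (n + 1) \ G n) := (hm _ _ (hGm (n + 1))).diff hGn
      have hlast : ε * P (G (n + 1) \ G n) ≤ ∫⁻ ω in G (n + 1) \ G n, Y (n + 1) ω ∂P := by
        rw [← setLIntegral_const]
        refine setLIntegral_mono ((hY (n + 1)).mono (hm (n + 1)) le_rfl) fun ω hω => ?_
        obtain ⟨⟨k, hk, h⟩, hn⟩ := hω
        rcases Nat.le_succ_iff.1 hk with hk' | hk'
        · exact absurd ⟨k, hk', h⟩ hn
        · rwa [hk'] at h
      calc ε * P (G (n + 1)) = ε * P (G n) + ε * P (G (n + 1) \ G n) := by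
            rw [← mul_add, ← measure_union Set.disjoint_sdiff_right hdiff,
              Set.union_sdiff_cancel hsub']
        _ ≤ ∫⁻ ω in G n, Y (n + 1) ω ∂P + ∫⁻ ω in G (n + 1) \ G n, Y (n + 1) ω ∂P :=
            add_le_add (ih.trans (hsub n _ (hGm n))) hlast
        _ = ∫⁻ ω in G (n + 1), Y (n + 1) ω ∂P := by
            rw [← lintegral_union hdiff Set.disjoint_sdiff_right, Set.union_sdiff_cancel hsub']
  have hU : {ω | ∃ k, ε ≤ Y k ω} = ⋃ n, G n := by
    ext ω
    simp only [hG, Set.mem_ofPred_eq, Set.mem_iUnion]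
    exact ⟨fun ⟨k, h⟩ => ⟨k, k, le_rfl, h⟩, fun ⟨_, k, _, h⟩ => ⟨k, h⟩⟩
  have hGmono : Monotone G := fun i j hij ω ⟨k, hk, h⟩ => ⟨k, hk.trans hij, h⟩
  rw [hU, hGmono.measure_iUnion, ENNReal.mul_iSup]
  exact iSup_le fun n => (hstep n).trans ((setLIntegral_le_lintegral _ _).trans (hc n))

theorem measure_exists_le_incrementEnergy {Ω : Type*} [MeasurableSpace Ω] {P : Measure Ω}
    [IsProbabilityMeasure P] {α : ℕ → Ω → ℂ} (hα : ∀ j, Measurable (α j))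
    (hindep : iIndepFun α P) (hsymm : ∀ j, IdentDistrib (fun ω => -α j ω) (α j) P P)
    (ν : Measure ℂ) [SFinite ν] (N : ℕ) (ε : ℝ≥0∞) :
    ε * P {ω | ∃ k, ε ≤ incrementEnergy ν (fun j => α j ω) N k}
      ≤ ∑' k, ∫⁻ ω, termEnergy ν (fun j => α j ω) (k + N) ∂P := by
  refine measure_exists_le_submartingale (m := fun k => pastAlgebra α (N + k))
    (fun i j hij => pastAlgebra_mono α (by lia)) (fun k => pastAlgebra_le hα _)
    (fun k => ?_) (fun k A hA => ?_) (fun k => ?_) ε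
  · exact @measurable_incrementEnergy Ω (pastAlgebra α (N + k)) ν _ α N k
      fun i hi => measurable_pastAlgebra α hi
  · rw [setLIntegral_incrementEnergy_succ hα hindep hsymm ν N k hA]
    exact le_self_add
  · refine le_trans (le_of_eq ?_) (ENNReal.sum_le_tsum (Finset.range k))
    induction k with
    | zero => simp [incrementEnergy]
    | succ k ih =>
      have h := setLIntegral_incrementEnergy_succ hα hindep hsymm ν N k MeasurableSet.univ
      simp only [Measure.restrict_univ] at h
      rw [h, ih, Finset.sum_range_succ, Nat.add_comm N k]

/-- For a fixed level, the event that no `N` works lies in the exceptional event of every `N`, whose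
probability is bounded by a constant times the tail of a convergent series. The countably many
levels `1 / (i + 1)` suffice. -/
theorem ae_exists_forall_incrementEnergy_lt {Ω : Type*} [MeasurableSpace Ω] {P : Measure Ω}
    [IsProbabilityMeasure P] {α : ℕ → Ω → ℂ} (hα : ∀ j, Measurable (α j))
    (hindep : iIndepFun α P) (hsymm : ∀ j, IdentDistrib (fun ω => -α j ω) (α j) P P)
    (ν : Measure ℂ) [SFinite ν]
    (hfin : ∑' n, ∫⁻ ω, termEnergy ν (fun j => α j ω) n ∂P ≠ ∞) :
    ∀ᵐ ω ∂P, ∀ ε : ℝ≥0∞, 0 < ε → ∃ N, ∀ k, incrementEnergy ν (fun j => α j ω) N k < ε := by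
  have hfix : ∀ i : ℕ, ∀ᵐ ω ∂P, ∃ N, ∀ k,
      incrementEnergy ν (fun j => α j ω) N k < ((i : ℝ≥0∞) + 1)⁻¹ := by
    intro i
    have htail := ENNReal.tendsto_sum_nat_add
      (fun n => ∫⁻ ω, termEnergy ν (fun j => α j ω) n ∂P) hfin
    have hε0 : ((i : ℝ≥0∞) + 1)⁻¹ ≠ 0 := by simp
    rw [ae_iff]
    have hle : ∀ N, ((i : ℝ≥0∞) + 1)⁻¹ * P {ω | ¬∃ N, ∀ k,
        incrementEnergy ν (fun j => α j ω) N k < ((i : ℝ≥0∞) + 1)⁻¹}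
        ≤ ∑' k, ∫⁻ ω, termEnergy ν (fun j => α j ω) (k + N) ∂P := by
      intro N
      refine le_trans ?_ (measure_exists_le_incrementEnergy hα hindep hsymm ν N ((i : ℝ≥0∞) + 1)⁻¹)
      gcongr
      intro hω
      push Not at hω
      exact hω N
    have := le_antisymm (ge_of_tendsto' htail hle) bot_le
    exact (mul_eq_zero.1 this).resolve_left hε0
  filter_upwards [ae_all_iff.2 hfix] with ω hω ε hε
  obtain ⟨i, hi⟩ := ENNReal.exists_inv_nat_lt hε.ne'
  obtain ⟨N, hN⟩ := hω i
  refine ⟨N, fun k => (hN k).trans_le (le_trans ?_ hi.le)⟩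
  exact ENNReal.inv_le_inv.2 le_self_add

/-! ### From mean squares on circles to uniform convergence -/

/-- The image of the arc length measure on the circle of radius `ρ`. -/
noncomputable def circleMeasure (ρ : ℝ) : Measure ℂ :=
  (volume.restrict (Set.Ioc 0 (2 * Real.pi))).map (circleMap 0 ρ)

instance (ρ : ℝ) : IsFiniteMeasure (circleMeasure ρ) := by
  unfold circleMeasure
  infer_instance

theorem ae_circleMeasure {ρ : ℝ} (hρ : 0 ≤ ρ) : ∀ᵐ z ∂circleMeasure ρ, ‖z‖ ≤ ρ := by
  rw [circleMeasure, ae_map_iff (by fun_prop) (measurableSet_le measurable_norm measurable_const)]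
  exact Eventually.of_forall fun θ => by simp [circleMap, abs_of_nonneg hρ]

/-- The mean square on a circle controls the supremum on a smaller disc. -/
theorem enorm_sq_le_lintegral_circleMeasure {f : ℂ → ℂ}
    (hf : DifferentiableOn ℂ f (Metric.ball 0 1)) (hfm : Measurable f) {r ρ : ℝ}
    (hrρ : r < ρ) (hρ : ρ < 1) {z : ℂ} (hz : ‖z‖ ≤ r) :
    ‖f z‖ₑ ^ 2 ≤ ENNReal.ofReal ((ρ - r)⁻¹) * ∫⁻ w, ‖f w‖ₑ ^ 2 ∂circleMeasure ρ := by
  have hρ0 : 0 < ρ := ((norm_nonneg z).trans hz).trans_lt hrρ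
  have hsub : Metric.closedBall (0 : ℂ) ρ ⊆ Metric.ball 0 1 := Metric.closedBall_subset_ball hρ
  -- Cauchy's formula is applied to `f ^ 2`, which yields the mean square directly.
  have hcauchy := ((hf.mono hsub).pow 2).circleIntegral_sub_inv_smul
    (w := z) (by simpa using hz.trans_lt hrρ)
  rw [circleMeasure, lintegral_map (hfm.enorm.pow_const 2) (by fun_prop)]
  have h2 : ‖(2 * Real.pi * Complex.I : ℂ)‖ₑ * ‖f z‖ₑ ^ 2
      ≤ ∫⁻ θ in Set.Ioc 0 (2 * Real.pi),
        ENNReal.ofReal ((ρ - r)⁻¹) * ‖f (circleMap 0 ρ θ)‖ₑ ^ 2 := by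
    rw [← enorm_pow, ← enorm_mul, ← smul_eq_mul]
    have : (f ^ 2) z = f z ^ 2 := rfl
    rw [← this, ← hcauchy, circleIntegral, intervalIntegral.integral_of_le (by positivity)]
    refine (enorm_integral_le_lintegral_enorm _).trans (lintegral_mono fun θ => ?_)
    rw [smul_smul, smul_eq_mul, enorm_mul, Pi.pow_apply, enorm_pow]
    gcongr
    rw [← ofReal_norm]
    refine ENNReal.ofReal_le_ofReal ?_
    have hd : ρ - r ≤ ‖circleMap 0 ρ θ - z‖ := by
      have h := norm_sub_norm_le (circleMap 0 ρ θ) z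
      have h' : ‖circleMap 0 ρ θ‖ = ρ := by simp [circleMap, abs_of_pos hρ0]
      linarith
    rw [norm_mul, norm_inv]
    have hdn : ‖deriv (circleMap 0 ρ) θ‖ ≤ 1 := by
      simp [deriv_circleMap, circleMap, abs_of_pos hρ0, hρ.le]
    exact (mul_le_of_le_one_left (by positivity) hdn).trans
      (inv_anti₀ (by linarith) hd)
  rw [← lintegral_const_mul' _ _ (by simp)]
  refine le_trans ?_ h2
  -- The factor `2π ≥ 1` is discarded.
  refine le_mul_of_one_le_left bot_le ?_
  rw [← ofReal_norm, ENNReal.one_le_ofReal]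
  have := Real.pi_gt_three
  simp only [norm_mul, Complex.norm_ofNat, Complex.norm_real, Complex.norm_I, Real.norm_eq_abs,
    abs_of_pos Real.pi_pos]
  linarith

theorem uniformCauchySeqOn_linearPart {a : ℕ → ℂ} (ha : ∀ j, ‖a j‖ < 1) {r ρ : ℝ}
    (hrρ : r < ρ) (hρ : ρ < 1)
    (hY : ∀ ε : ℝ≥0∞, 0 < ε → ∃ N, ∀ k, incrementEnergy (circleMeasure ρ) a N k < ε) :
    UniformCauchySeqOn (linearPart a) atTop (Metric.closedBall 0 r) := by
  rw [Metric.uniformCauchySeqOn_iff]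
  intro δ hδ
  have hC : 0 < (ρ - r)⁻¹ := inv_pos.2 (by linarith)
  -- The factor `ρ - r` cancels the constant `(ρ - r)⁻¹` lost in passing from the circle to the
  -- disc.
  obtain ⟨N, hN⟩ := hY (ENNReal.ofReal ((ρ - r) * (δ / 2) ^ 2))
    (ENNReal.ofReal_pos.2 (mul_pos (by linarith) (by positivity)))
  have hclose : ∀ n ≥ N, ∀ z ∈ Metric.closedBall (0 : ℂ) r,
      dist (linearPart a n z) (linearPart a N z) < δ / 2 := by
    intro n hn z hz
    obtain ⟨k, rfl⟩ := Nat.exists_eq_add_of_le hn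
    have h := enorm_sq_le_lintegral_circleMeasure
      (f := fun z => linearPart a (N + k) z - linearPart a N z)
      ((differentiableOn_linearPart ha (N + k)).sub (differentiableOn_linearPart ha N))
      ((measurable_linearPart_apply a (N + k)).sub (measurable_linearPart_apply a N)) hrρ hρ
      (mem_closedBall_zero_iff.1 hz)
    have h' := h.trans_lt ((ENNReal.mul_lt_mul_iff_right (ENNReal.ofReal_pos.2 hC).ne'
      ENNReal.ofReal_ne_top).2 (hN k))
    rw [← ENNReal.ofReal_mul hC.le, inv_mul_cancel_left₀ (by linarith : ρ - r ≠ 0), ← ofReal_norm,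
      ← ENNReal.ofReal_pow (norm_nonneg _), ENNReal.ofReal_lt_ofReal_iff (by positivity)] at h'
    rw [dist_eq_norm]
    exact lt_of_pow_lt_pow_left₀ 2 (by positivity) h'
  refine ⟨N, fun m hm n hn z hz => ?_⟩
  have h1 := hclose m hm z hz
  have h2 := hclose n hn z hz
  have h3 := dist_triangle_right (linearPart a m z) (linearPart a n z) (linearPart a N z)
  linarith

/-- The pathwise bound by `1 + ∑ |aⱼ|³` is weakened by `1 + x ≤ exp x`, so that the exponential
moment with parameter `1` makes the expected energies summable. -/
theorem sum_termEnergy_le {a : ℕ → ℂ} (ha : ∀ j, ‖a j‖ < 1) {ρ : ℝ} (hρ1 : ρ < 1)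
    {ν : Measure ℂ} (hν : ∀ᵐ z ∂ν, ‖z‖ ≤ ρ) (n : ℕ) :
    ∑ j ∈ Finset.range n, termEnergy ν a j
      ≤ ENNReal.ofReal (cubeConst ρ) * ν Set.univ *
        ENNReal.ofReal (Real.exp (1 * ∑ j ∈ Finset.range n, ‖a j‖ ^ 3)) := by
  have hm : ∀ j, Measurable fun z => ‖a j * schurRatio a j z‖ₑ ^ 2 := fun j =>
    ((measurable_schurRatio_apply a j).const_mul (a j)).enorm.pow_const 2
  unfold termEnergy
  rw [← lintegral_finsetSum _ fun j _ => hm j]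
  calc ∫⁻ z, ∑ j ∈ Finset.range n, ‖a j * schurRatio a j z‖ₑ ^ 2 ∂ν
      ≤ ∫⁻ _, ENNReal.ofReal (cubeConst ρ *
          Real.exp (1 * ∑ j ∈ Finset.range n, ‖a j‖ ^ 3)) ∂ν := by
        refine lintegral_mono_ae ?_
        filter_upwards [hν] with z hz
        have e : ∀ j, ‖a j * schurRatio a j z‖ₑ ^ 2
            = ENNReal.ofReal (‖a j * schurRatio a j z‖ ^ 2) := fun j => by
          rw [ENNReal.ofReal_pow (norm_nonneg _), ofReal_norm]
        simp only [e]
        rw [← ENNReal.ofReal_sum_of_nonneg fun j _ => by positivity]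
        refine ENNReal.ofReal_le_ofReal ((sum_norm_mul_schurRatio_sq_le ha hρ1 hz n).trans
          (mul_le_mul_of_nonneg_left ?_ (cubeConst_pos hρ1).le))
        rw [one_mul, add_comm]
        exact Real.add_one_le_exp _
    _ = _ := by
        rw [lintegral_const, ENNReal.ofReal_mul (cubeConst_pos hρ1).le]
        ring

theorem tsum_lintegral_termEnergy_ne_top {Ω : Type*} [MeasurableSpace Ω] {P : Measure Ω}
    {α : ℕ → Ω → ℂ} (hα : ∀ j, Measurable (α j)) (hdisc : ∀ j ω, ‖α j ω‖ < 1) {c : ℝ≥0∞}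
    (hc : c ≠ ∞) (hexp : ∀ n, ∫⁻ ω, ENNReal.ofReal
      (Real.exp (1 * ∑ j ∈ Finset.range n, ‖α j ω‖ ^ 3)) ∂P ≤ c)
    {ρ : ℝ} (hρ1 : ρ < 1) {ν : Measure ℂ} [IsFiniteMeasure ν] (hν : ∀ᵐ z ∂ν, ‖z‖ ≤ ρ) :
    ∑' n, ∫⁻ ω, termEnergy ν (fun j => α j ω) n ∂P ≠ ∞ := by
  have hK : ENNReal.ofReal (cubeConst ρ) * ν Set.univ ≠ ∞ :=
    ENNReal.mul_ne_top ENNReal.ofReal_ne_top (measure_ne_top ν _)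
  refine ne_top_of_le_ne_top (ENNReal.mul_ne_top hK hc)
    (ENNReal.tsum_le_of_sum_range_le fun n => ?_)
  rw [← lintegral_finsetSum _ fun j _ => measurable_termEnergy ν hα j]
  refine (lintegral_mono fun ω => sum_termEnergy_le (fun j => hdisc j ω) hρ1 hν n).trans ?_
  rw [lintegral_const_mul' _ _ hK]
  gcongr
  exact hexp n

theorem ae_summable_norm_cube {Ω : Type*} [MeasurableSpace Ω] {P : Measure Ω}
    {α : ℕ → Ω → ℂ} (hα : ∀ j, Measurable (α j)) {c : ℝ≥0∞}
    (hc : c ≠ ∞) (hexp : ∀ n, ∫⁻ ω, ENNReal.ofReal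
      (Real.exp (1 * ∑ j ∈ Finset.range n, ‖α j ω‖ ^ 3)) ∂P ≤ c) :
    ∀ᵐ ω ∂P, Summable fun j => ‖α j ω‖ ^ 3 := by
  have hm : ∀ j, Measurable fun ω => ENNReal.ofReal (‖α j ω‖ ^ 3) := fun j =>
    ((hα j).norm.pow_const 3).ennreal_ofReal
  have hfin : ∫⁻ ω, ∑' j, ENNReal.ofReal (‖α j ω‖ ^ 3) ∂P ≠ ∞ := by
    rw [lintegral_tsum fun j => (hm j).aemeasurable]
    refine ne_top_of_le_ne_top hc (ENNReal.tsum_le_of_sum_range_le fun n => ?_)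
    rw [← lintegral_finsetSum _ fun j _ => hm j]
    refine (lintegral_mono fun ω => ?_).trans (hexp n)
    rw [← ENNReal.ofReal_sum_of_nonneg fun j _ => by positivity]
    refine ENNReal.ofReal_le_ofReal ?_
    rw [one_mul]
    linarith [Real.add_one_le_exp (∑ j ∈ Finset.range n, ‖α j ω‖ ^ 3)]
  filter_upwards [ae_lt_top (Measurable.tsum hm) hfin] with ω hω
  have h := ENNReal.summable_toReal hω.ne
  refine h.congr fun j => ?_
  rw [ENNReal.toReal_ofReal (by positivity)]

theorem exists_closedBall_of_isCompact {K : Set ℂ} (hK : IsCompact K)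
    (hsub : K ⊆ Metric.ball 0 1) : ∃ r, 0 ≤ r ∧ r < 1 ∧ K ⊆ Metric.closedBall 0 r := by
  rcases K.eq_empty_or_nonempty with rfl | hne
  · exact ⟨0, le_rfl, one_pos, Set.empty_subset _⟩
  · obtain ⟨w, hw, hmax⟩ := hK.exists_isMaxOn hne continuous_norm.continuousOn
    exact ⟨‖w‖, norm_nonneg w, by simpa using hsub hw, fun z hz => by simpa using hmax hz⟩

theorem ae_tendstoUniformlyOn_logOpucStar {Ω : Type*} [MeasurableSpace Ω] {P : Measure Ω}
    [IsProbabilityMeasure P] {α : ℕ → Ω → ℂ} (hα : ∀ j, Measurable (α j))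
    (hdisc : ∀ j ω, ‖α j ω‖ < 1)
    (hindep : iIndepFun α P) (hsymm : ∀ j, IdentDistrib (fun ω => -α j ω) (α j) P P) {c : ℝ≥0∞}
    (hc : c ≠ ∞) (hexp : ∀ n, ∫⁻ ω, ENNReal.ofReal
      (Real.exp (1 * ∑ j ∈ Finset.range n, ‖α j ω‖ ^ 3)) ∂P ≤ c) :
    ∀ᵐ ω ∂P, ∃ g : ℂ → ℂ, ∀ K : Set ℂ, IsCompact K → K ⊆ Metric.ball 0 1 →
      TendstoUniformlyOn (fun n z => logOpucStar (fun j => α j ω) n z) g atTop K := by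
  -- Countably many radii tending to `1` give one almost sure event valid for all compact sets.
  have hρ : ∀ i : ℕ, 0 ≤ 1 - 1 / ((i : ℝ) + 1) ∧ 1 - 1 / ((i : ℝ) + 1) < 1 := fun i => by
    have h1 : (0 : ℝ) < 1 / ((i : ℝ) + 1) := by positivity
    have h2 : 1 / ((i : ℝ) + 1) ≤ 1 := by
      rw [div_le_one (by positivity)]
      linarith [(Nat.cast_nonneg i : (0 : ℝ) ≤ i)]
    exact ⟨by linarith, by linarith⟩
  have hY := ae_all_iff.2 fun i : ℕ => ae_exists_forall_incrementEnergy_lt hα hindep hsymm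
    (circleMeasure (1 - 1 / ((i : ℝ) + 1)))
    (tsum_lintegral_termEnergy_ne_top hα hdisc hc hexp (hρ i).2 (ae_circleMeasure (hρ i).1))
  filter_upwards [hY, ae_summable_norm_cube hα hc hexp] with ω hω hsum
  have ha : ∀ j, ‖α j ω‖ < 1 := fun j => hdisc j ω
  have hcauchy : ∀ r, 0 ≤ r → r < 1 → UniformCauchySeqOn (logOpucStar fun j => α j ω) atTop
      (Metric.closedBall 0 r) := by
    intro r hr hr1
    obtain ⟨i, hi⟩ := exists_nat_one_div_lt (sub_pos.2 hr1)
    exact uniformCauchySeqOn_logOpucStar ha hsum hr hr1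
      (uniformCauchySeqOn_linearPart ha (by linarith) (hρ i).2 (hω i))
  -- The limit is defined pointwise, hence does not depend on `K`.
  refine ⟨fun z => limUnder atTop fun n => logOpucStar (fun j => α j ω) n z,
    fun K hK hsub => ?_⟩
  obtain ⟨r, hr, hr1, hKr⟩ := exists_closedBall_of_isCompact hK hsub
  exact ((hcauchy r hr hr1).mono hKr).tendstoUniformlyOn_of_tendsto fun z hz =>
    ((hcauchy r hr hr1).cauchySeq (hKr hz)).tendsto_limUnder

/-! ### Uniform exponential moments -/

theorem measurable_logOpucStar {Ω : Type*} [MeasurableSpace Ω] {α : ℕ → Ω → ℂ}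
    (hα : ∀ j, Measurable (α j)) (hdisc : ∀ j ω, ‖α j ω‖ < 1) (n : ℕ) {z : ℂ}
    (hz : z ∈ Metric.ball (0 : ℂ) 1) :
    Measurable fun ω => logOpucStar (fun j => α j ω) n z := by
  have h : (fun ω => logOpucStar (fun j => α j ω) n z) = fun ω => ∑ j ∈ Finset.range n,
      Complex.log (1 + -(α j ω * schurRatio (fun j => α j ω) j z)) :=
    funext fun ω => logOpucStar_eq_sum (fun j => hdisc j ω) n hz
  rw [h]
  refine Finset.measurable_fun_sum _ fun j _ => ?_
  have hB : Measurable fun ω => schurRatio (fun j => α j ω) j z :=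
    (measurable_schurRatio fun i _ => hα i).comp measurable_prodMk_right
  exact Complex.measurable_log.comp (((hα j).mul hB).neg.const_add 1)

theorem exists_integral_exp_logOpucStar_le {Ω : Type*} [MeasurableSpace Ω] {P : Measure Ω}
    [IsProbabilityMeasure P] {α : ℕ → Ω → ℂ} (hα : ∀ j, Measurable (α j))
    (hdisc : ∀ j ω, ‖α j ω‖ < 1)
    (hindep : iIndepFun α P) (hsymm : ∀ j, IdentDistrib (fun ω => -α j ω) (α j) P P)
    (hexp : ∀ s : ℝ, 0 < s → ∃ c : ℝ≥0∞, c ≠ ∞ ∧ ∀ n, ∫⁻ ω, ENNReal.ofReal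
      (Real.exp (s * ∑ j ∈ Finset.range n, ‖α j ω‖ ^ 3)) ∂P ≤ c)
    {r : ℝ} (hr1 : r < 1) (σ : ℂ) :
    ∃ C : ℝ, ∀ z : ℂ, ‖z‖ ≤ r → ∀ n : ℕ,
      Integrable (fun ω => Real.exp (σ * logOpucStar (fun j => α j ω) n z).re) P ∧
      ∫ ω, Real.exp (σ * logOpucStar (fun j => α j ω) n z).re ∂P ≤ C := by
  set d : ℝ := 2 * ((‖σ‖ ^ 2 + ‖σ‖ * (1 - r)⁻¹) * cubeConst r) with hd
  have hinv : 0 ≤ (1 - r)⁻¹ := inv_nonneg.2 (by linarith)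
  have hd0 : 0 ≤ d := by
    have := cubeConst_pos hr1
    positivity
  -- `d` vanishes when `σ = 0`, whereas the moment bound needs a positive parameter; hence `d + 1`.
  obtain ⟨c, hc, hbound⟩ := hexp (d + 1) (by linarith)
  have htop : 1 + ENNReal.ofReal (Real.exp d) * c ≠ ∞ :=
    ENNReal.add_ne_top.2 ⟨ENNReal.one_ne_top, ENNReal.mul_ne_top ENNReal.ofReal_ne_top hc⟩
  refine ⟨(1 + ENNReal.ofReal (Real.exp d) * c).toReal, fun z hz n => ?_⟩
  have hmeas : Measurable fun ω => Real.exp (σ * logOpucStar (fun j => α j ω) n z).re :=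
    (Complex.measurable_re.comp ((measurable_logOpucStar hα hdisc n
      (mem_ball_of_norm_le hr1 hz)).const_mul σ)).exp
  have hle : ∫⁻ ω, ENNReal.ofReal (Real.exp (σ * logOpucStar (fun j => α j ω) n z).re) ∂P
      ≤ 1 + ENNReal.ofReal (Real.exp d) * c := by
    calc ∫⁻ ω, ENNReal.ofReal (Real.exp (σ * logOpucStar (fun j => α j ω) n z).re) ∂P
        ≤ ∫⁻ ω, (ENNReal.ofReal
            (Real.exp (compensatedExponent (-(2 * σ)) (fun j => α j ω) n z))
            + ENNReal.ofReal (Real.exp d) * ENNReal.ofReal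
              (Real.exp ((d + 1) * ∑ j ∈ Finset.range n, ‖α j ω‖ ^ 3))) ∂P := by
          refine lintegral_mono fun ω => ?_
          rw [← ENNReal.ofReal_mul (Real.exp_pos _).le,
            ← ENNReal.ofReal_add (Real.exp_pos _).le (by positivity), ← Real.exp_add]
          refine ENNReal.ofReal_le_ofReal
            ((exp_re_logOpucStar_le (fun j => hdisc j ω) hr1 hz σ n).trans
              (add_le_add_right (Real.exp_le_exp.2 ?_) _))
          have hT : 0 ≤ ∑ j ∈ Finset.range n, ‖α j ω‖ ^ 3 :=
            Finset.sum_nonneg fun _ _ => by positivity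
          rw [hd]
          linarith
      _ ≤ 1 + ENNReal.ofReal (Real.exp d) * c := by
          rw [lintegral_add_left
            (measurable_compensatedExponent (fun i _ => hα i) _ z).exp.ennreal_ofReal,
            lintegral_const_mul' _ _ ENNReal.ofReal_ne_top]
          gcongr
          · exact lintegral_exp_compensatedExponent_le hα hindep hsymm _ z n
          · exact hbound n
  refine ⟨⟨hmeas.aestronglyMeasurable, ?_⟩, ?_⟩
  · rw [hasFiniteIntegral_iff_ofReal (Eventually.of_forall fun ω => (Real.exp_pos _).le)]
    exact hle.trans_lt htop.lt_top
  · rw [integral_eq_lintegral_of_nonneg_ae (Eventually.of_forall fun ω => (Real.exp_pos _).le)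
      hmeas.aestronglyMeasurable]
    exact ENNReal.toReal_mono htop hle

/-! ### Reduction to coefficients lying everywhere in the disc -/

/-- Passes from the extended-valued full series of the hypothesis to real partial sums; `a` stands
for the truncation of `b`. -/
theorem ofReal_exp_sum_le_eReal_exp {a b : ℕ → ℂ} (hab : ∀ j, ‖a j‖ ≤ ‖b j‖) {s : ℝ}
    (hs : 0 ≤ s) (n : ℕ) :
    ENNReal.ofReal (Real.exp (s * ∑ j ∈ Finset.range n, ‖a j‖ ^ 3))
      ≤ EReal.exp ((ENNReal.ofReal s * ∑' j, ‖b j‖ₑ ^ 3 : ℝ≥0∞) : EReal) := by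
  have hT : 0 ≤ ∑ j ∈ Finset.range n, ‖a j‖ ^ 3 := Finset.sum_nonneg fun _ _ => by positivity
  rw [← EReal.exp_coe]
  refine EReal.exp_monotone ?_
  have h : ENNReal.ofReal (s * ∑ j ∈ Finset.range n, ‖a j‖ ^ 3)
      ≤ ENNReal.ofReal s * ∑' j, ‖b j‖ₑ ^ 3 := by
    rw [ENNReal.ofReal_mul hs, ENNReal.ofReal_sum_of_nonneg fun _ _ => by positivity]
    gcongr
    refine le_trans (Finset.sum_le_sum fun j _ => ?_) (ENNReal.sum_le_tsum (Finset.range n))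
    rw [ENNReal.ofReal_pow (norm_nonneg _), ← ofReal_norm]
    gcongr
    exact hab j
  refine le_trans (le_of_eq ?_) (EReal.coe_ennreal_le_coe_ennreal_iff.2 h)
  rw [EReal.coe_ennreal_ofReal, max_eq_left (mul_nonneg hs hT)]

open Classical in
/-- The identity inside the open unit disc, zero outside. -/
noncomputable def discTruncation (x : ℂ) : ℂ := if ‖x‖ < 1 then x else 0

theorem measurable_discTruncation : Measurable discTruncation :=
  Measurable.ite (measurableSet_lt measurable_norm measurable_const) measurable_id measurable_const

theorem norm_discTruncation_lt_one (x : ℂ) : ‖discTruncation x‖ < 1 := by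
  unfold discTruncation
  split_ifs with h
  · exact h
  · simp

theorem norm_discTruncation_le (x : ℂ) : ‖discTruncation x‖ ≤ ‖x‖ := by
  unfold discTruncation
  split_ifs with h
  · exact le_rfl
  · simp

theorem discTruncation_neg (x : ℂ) : discTruncation (-x) = -discTruncation x := by
  unfold discTruncation
  rw [norm_neg]
  split_ifs <;> simp

theorem mainTheorem6 {Ω : Type*} [MeasurableSpace Ω] (P : Measure Ω) [IsProbabilityMeasure P]
    (α : ℕ → Ω → ℂ)
    (hmeas : ∀ j, Measurable (α j))
    (hdisc : ∀ j, ∀ᵐ ω ∂P, ‖α j ω‖ < 1)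
    (hindep : iIndepFun α P)
    (hrot : ∀ j, ∀ c : ℂ, ‖c‖ = 1 → IdentDistrib (fun ω => c * α j ω) (α j) P P)
    (hexp : ∀ σ : ℝ, 0 < σ → ∀ k : ℕ, 3 ≤ k →
      ∫⁻ ω, EReal.exp ((ENNReal.ofReal σ * ∑' j, ‖α j ω‖ₑ ^ k : ℝ≥0∞) : EReal) ∂P < ∞) :
    (∀ᵐ ω ∂P, ∃ g : ℂ → ℂ, ∀ K : Set ℂ, IsCompact K → K ⊆ Metric.ball 0 1 →
      TendstoUniformlyOn (fun n z => logOpucStar (fun j => α j ω) n z) g atTop K) ∧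
    (∀ K : Set ℂ, IsCompact K → K ⊆ Metric.ball 0 1 → ∀ σ : ℂ, ∃ C : ℝ, ∀ z ∈ K, ∀ n : ℕ,
      Integrable (fun ω => Real.exp (σ * logOpucStar (fun j => α j ω) n z).re) P ∧
      ∫ ω, Real.exp (σ * logOpucStar (fun j => α j ω) n z).re ∂P ≤ C) := by

  -- The coefficients lie in the disc only almost surely. Truncation puts them there for every `ω`;
  -- being odd, measurable and norm-decreasing, it preserves symmetry, independence and the moment
  -- bounds, and almost surely it changes nothing.
  have hβm : ∀ j, Measurable fun ω => discTruncation (α j ω) := fun j =>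
    measurable_discTruncation.comp (hmeas j)
  have hβd : ∀ j ω, ‖discTruncation (α j ω)‖ < 1 := fun j ω => norm_discTruncation_lt_one _
  have hβi : iIndepFun (fun j ω => discTruncation (α j ω)) P :=
    hindep.comp (fun _ => discTruncation) fun _ => measurable_discTruncation
  have hβs : ∀ j, IdentDistrib (fun ω => -discTruncation (α j ω))
      (fun ω => discTruncation (α j ω)) P P := fun j => by
    -- Rotation by `c = -1` is the symmetry of the law.
    have h := (hrot j (-1) (by simp)).comp measurable_discTruncation
    simpa [Function.comp_def, discTruncation_neg] using h
  have hβe : ∀ s : ℝ, 0 < s → ∃ c : ℝ≥0∞, c ≠ ∞ ∧ ∀ n, ∫⁻ ω, ENNReal.ofReal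
      (Real.exp (s * ∑ j ∈ Finset.range n, ‖discTruncation (α j ω)‖ ^ 3)) ∂P ≤ c :=
    fun s hs => ⟨_, (hexp s hs 3 le_rfl).ne, fun n => lintegral_mono fun ω =>
      ofReal_exp_sum_le_eReal_exp (fun j => norm_discTruncation_le (α j ω)) hs.le n⟩
  have heq : ∀ᵐ ω ∂P, (fun j => discTruncation (α j ω)) = fun j => α j ω := by
    filter_upwards [ae_all_iff.2 hdisc] with ω hω
    exact funext fun j => if_pos (hω j)
  refine ⟨?_, fun K hK hsub σ => ?_⟩
  · obtain ⟨c, hc, hbound⟩ := hβe 1 one_pos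
    filter_upwards [heq, ae_tendstoUniformlyOn_logOpucStar hβm hβd hβi hβs hc hbound] with ω h1 h2
    rwa [h1] at h2
  · obtain ⟨r, -, hr1, hKr⟩ := exists_closedBall_of_isCompact hK hsub
    obtain ⟨C, hC⟩ := exists_integral_exp_logOpucStar_le hβm hβd hβi hβs hβe hr1 σ
    refine ⟨C, fun z hz n => ?_⟩
    obtain ⟨hint, hle⟩ := hC z (by simpa using hKr hz) n
    have hae : (fun ω => Real.exp (σ * logOpucStar (fun j => discTruncation (α j ω)) n z).re)
        =ᵐ[P] fun ω => Real.exp (σ * logOpucStar (fun j => α j ω) n z).re := by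
      filter_upwards [heq] with ω hω
      rw [hω]
    exact ⟨hint.congr hae, (integral_congr_ae hae).symm.trans_le hle⟩
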